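/- Let $W(E_7^{(1)})=\langle s_0,\dots,s_7\rangle$ be the affine Weyl (Coxeter) group of type $E_7^{(1)}$, whose Dynkin diagram is the chain $0-1-3-4-5-6-7$ with the node $2$ attached to $4$. Let $\widetilde W(E_7^{(1)})=W(E_7^{(1)})\rtimes\langle\sigma\rangle$ be the extended affine Weyl group, where $\sigma$ is the diagram automorphism $(0\,7)(1\,6)(3\,5)$, so that $\sigma^2=1$ and $\sigma s_i=s_{\sigma(i)}\sigma$. This group acts on the real vector space with basis the simple roots $\alpha_0,\dots,\alpha_7$ by $s_j(\alpha_i)=\alpha_i-a_{ij}\alpha_j$, where $(a_{ij})$ is the Cartan matrix of type $E_7^{(1)}$, and by $\sigma(\alpha_i)=\alpha_{\sigma(i)}$. Let $J=\{\alpha_0,\alpha_3,\alpha_5,\alpha_7\}$ (which is of type $4A_1$), let $W_J=\langle s_0,s_3,s_5,s_7\rangle$, let $N(W_J)$ be the normaliser of $W_J$ in $\widetilde W(E_7^{(1)})$, and let $N_J=\{w\in\widetilde W(E_7^{(1)})\mid wJ=J\}$. Put $$b_1=s_6s_5s_7s_6,\qquad b_2=s_4s_5s_3s_4,\qquad b_3=s_2,\qquad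 b_0=s_1s_3s_0s_1 .$$ Then, as internal semidirect products of subgroups, $$N(W_J)=N_J\ltimes W_J,\qquad N_J=\langle b_1,b_2,b_3,b_0\rangle\rtimes\langle\sigma\rangle .$$ Moreover $$N(W_J)=\bigl(\langle b_1,b_2,b_3,b_0\rangle\rtimes\langle\sigma\rangle\bigr)\ltimes\langle s_0,s_3,s_5,s_7\rangle\;\cong\;\widetilde W(B_3^{(1)})\ltimes W(4A_1).$$ Here $W(4A_1)$ is the Coxeter group of four disconnected nodes, and $\widetilde W(B_3^{(1)})=W(B_3^{(1)})\rtimes\langle\sigma'\rangle$ is the extended affine Weyl group of type $B_3^{(1)}$: in its Dynkin diagram the nodes $0$ and $1$ are each joined to the node $2$ by a single bond, $2$ is joined to the short node $3$ by a double bond, and $\sigma'$ is the diagram automorphism exchanging $0$ and $1$. The isomorphism can be chosen so that the simple reflections of $\widetilde W(B_3^{(1)})$ with indices $0,1,2,3$ correspond to $b_0,b_1,b_2,b_3$, the automorphism $\sigma'$ corresponds to $\sigma$, and the four generators of $W(4A_1)$ correspond to $s_0,s_3,s_5,s_7$. -/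

import Mathlib

namespace AffineWeyl

/-! ### Coxeter groups, diagram automorphisms and extended groups attached to a Cartan matrix -/

section General

variable {B : Type} [DecidableEq B]

/-- A generalized Cartan matrix (with integer entries). -/
structure IsCartan (a : Matrix B B ℤ) : Prop where
  diag : ∀ i, a i i = 2
  nonpos : ∀ i j, i ≠ j → a i j ≤ 0
  zero : ∀ i j, a i j = 0 → a j i = 0

/-- The Coxeter matrix of a generalized Cartan matrix: `m i i = 1`, and for `i ≠ j` the entry
`m i j` is `2, 3, 4, 6` when `a i j * a j i` is `0, 1, 2, 3` (no bond, a single, double or triple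
bond). In all other cases there is no relation (`m i j = 0`, which encodes infinity). -/
def coxeterMatrix (a : Matrix B B ℤ) : CoxeterMatrix B where
  M i j := if i = j then 1 else
    if a i j * a j i = 0 then 2 else
    if a i j * a j i = 1 then 3 else
    if a i j * a j i = 2 then 4 else
    if a i j * a j i = 3 then 6 else 0
  isSymm := by
    refine Matrix.IsSymm.ext fun i j => ?_
    simp only [eq_comm (a := j) (b := i), mul_comm (a j i) (a i j)]
  diagonal i := by simp
  off_diagonal i j h := by
    simp only [if_neg h]
    split_ifs <;> decide

/-- The Weyl group `W(Γ)`: generators `s i`, one for each node of the Dynkin diagram, and the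
Coxeter relations. -/
abbrev WeylGroup (a : Matrix B B ℤ) : Type := (coxeterMatrix a).Group

/-- The automorphisms of the Dynkin diagram: the permutations of the nodes that preserve the
Cartan matrix. -/
def diagramAut (a : Matrix B B ℤ) : Subgroup (Equiv.Perm B) where
  carrier := {e | ∀ i j, a (e i) (e j) = a i j}
  one_mem' := fun _ _ => rfl
  mul_mem' := by
    intro e f he hf i j
    simp only [Set.mem_ofPred_eq] at he hf
    simp [Equiv.Perm.mul_apply, he, hf]
  inv_mem' := by
    intro e he i j
    have := he (e⁻¹ i) (e⁻¹ j)
    simpa using this.symm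

theorem mem_diagramAut {a : Matrix B B ℤ} {e : Equiv.Perm B} :
    e ∈ diagramAut a ↔ ∀ i j, a (e i) (e j) = a i j := Iff.rfl

/-- The endomorphism `s i ↦ s (e i)` of the Weyl group. -/
def autHom (a : Matrix B B ℤ) (e : diagramAut a) : WeylGroup a →* WeylGroup a :=
  (coxeterMatrix a).toCoxeterSystem.lift
    ⟨fun i => (coxeterMatrix a).simple (e.1 i), by
      intro i j
      have h : coxeterMatrix a i j = coxeterMatrix a (e.1 i) (e.1 j) := by
        have h1 := e.2 i j
        have h2 := e.2 j i
        simp only [coxeterMatrix, h1, h2, EmbeddingLike.apply_eq_iff_eq]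
      rw [h]
      exact (coxeterMatrix a).toCoxeterSystem.simple_mul_simple_pow _ _⟩

theorem autHom_simple (a : Matrix B B ℤ) (e : diagramAut a) (i : B) :
    autHom a e ((coxeterMatrix a).simple i) = (coxeterMatrix a).simple (e.1 i) :=
  (coxeterMatrix a).toCoxeterSystem.lift_apply_simple _ i

theorem weylGroup_hom_ext (a : Matrix B B ℤ) {G : Type} [Monoid G] {f g : WeylGroup a →* G}
    (h : ∀ i, f ((coxeterMatrix a).simple i) = g ((coxeterMatrix a).simple i)) : f = g :=
  (coxeterMatrix a).toCoxeterSystem.ext_simple h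

/-- The action of the diagram automorphisms on the Weyl group by automorphisms. -/
def autAction (a : Matrix B B ℤ) : diagramAut a →* MulAut (WeylGroup a) where
  toFun e := (autHom a e).toMulEquiv (autHom a e⁻¹)
    (weylGroup_hom_ext a fun i => by simp [autHom_simple])
    (weylGroup_hom_ext a fun i => by simp [autHom_simple])
  map_one' := by
    ext w
    have : autHom a 1 = MonoidHom.id _ := weylGroup_hom_ext a fun i => by simp [autHom_simple]
    simp [this]
  map_mul' e f := by
    ext w
    have : autHom a (e * f) = (autHom a e).comp (autHom a f) :=
      weylGroup_hom_ext a fun i => by simp [autHom_simple]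
    simp [this]

/-- The extension `W(Γ) ⋊ ⟨σ⟩` of the Weyl group by the cyclic group generated by a diagram
automorphism `σ`. -/
abbrev ExtendedWeylGroup (a : Matrix B B ℤ) (σ : diagramAut a) : Type :=
  WeylGroup a ⋊[(autAction a).comp (Subgroup.zpowers σ).subtype] (Subgroup.zpowers σ)

/-- The simple reflection `s i` as an element of `W(Γ) ⋊ ⟨σ⟩`. -/
def simpleRefl (a : Matrix B B ℤ) (σ : diagramAut a) (i : B) : ExtendedWeylGroup a σ :=
  SemidirectProduct.inl ((coxeterMatrix a).simple i)

/-- The diagram automorphism `σ` as an element of `W(Γ) ⋊ ⟨σ⟩`. -/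
def diagGen (a : Matrix B B ℤ) (σ : diagramAut a) : ExtendedWeylGroup a σ :=
  SemidirectProduct.inr ⟨σ, Subgroup.mem_zpowers σ⟩

theorem diagGen_mul_simpleRefl (a : Matrix B B ℤ) (σ : diagramAut a) (i : B) :
    diagGen a σ * simpleRefl a σ i = simpleRefl a σ (σ.1 i) * diagGen a σ := by
  have h := SemidirectProduct.inl_aut (φ := (autAction a).comp (Subgroup.zpowers σ).subtype)
    ⟨σ, Subgroup.mem_zpowers σ⟩ ((coxeterMatrix a).simple i)
  have h1 : (((autAction a).comp (Subgroup.zpowers σ).subtype) ⟨σ, Subgroup.mem_zpowers σ⟩)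
      ((coxeterMatrix a).simple i) = (coxeterMatrix a).simple (σ.1 i) := autHom_simple a σ i
  rw [h1, map_inv] at h
  exact (eq_mul_inv_iff_mul_eq.1 h).symm

/-! ### The action on the real vector space spanned by the simple roots -/

/-- The simple root `α i`, a basis vector of `V = B → ℝ`. -/
def root (i : B) : B → ℝ := Pi.single i 1

variable [Fintype B]

/-- The linear form `v ↦ ⟨v, α j ^∨⟩` on `V`, with `⟨α i, α j ^∨⟩ = a i j`. -/
def coroot (a : Matrix B B ℤ) (j : B) : Module.Dual ℝ (B → ℝ) :=
  ∑ i, (a i j : ℝ) • LinearMap.proj i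

theorem coroot_root (a : Matrix B B ℤ) (i j : B) : coroot a j (root i) = a i j := by
  simp [coroot, root, Pi.single_apply]

/-- The reflection `v ↦ v - ⟨v, α j ^∨⟩ α j`. -/
noncomputable def reflLin {a : Matrix B B ℤ} (ha : IsCartan a) (j : B) :
    (B → ℝ) ≃ₗ[ℝ] (B → ℝ) :=
  Module.reflection (x := root j) (f := coroot a j) (by rw [coroot_root, ha.diag]; norm_num)

theorem reflLin_apply {a : Matrix B B ℤ} (ha : IsCartan a) (j : B) (v : B → ℝ) :
    reflLin ha j v = v - coroot a j v • root j := rfl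

/-- `s j (α i) = α i - a i j • α j`. -/
theorem reflLin_root {a : Matrix B B ℤ} (ha : IsCartan a) (i j : B) :
    reflLin ha j (root i) = root i - (a i j : ℝ) • root j := by
  rw [reflLin_apply, coroot_root]

theorem reflLin_isLiftable {a : Matrix B B ℤ} (ha : IsCartan a) :
    (coxeterMatrix a).IsLiftable (reflLin ha) := by
  intro i j
  by_cases hij : i = j
  · subst hij
    ext1 v
    simp only [coxeterMatrix, if_true, pow_one, LinearEquiv.mul_apply, reflLin_apply, map_sub,
      map_smul, coroot_root, ha.diag, LinearEquiv.coe_one, id]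
    push_cast
    module
  have hii : coroot a i (root i) = 2 := by rw [coroot_root, ha.diag]; norm_num
  have hjj : coroot a j (root j) = 2 := by rw [coroot_root, ha.diag]; norm_num
  have key : ∀ x y : ℤ, a i j = x → a j i = y →
      coroot a j (root i) = x ∧ coroot a i (root j) = y := by
    rintro x y rfl rfl
    exact ⟨coroot_root a i j, coroot_root a j i⟩
  have n1 := ha.nonpos i j hij
  have n2 := ha.nonpos j i (Ne.symm hij)
  simp only [coxeterMatrix, if_neg hij]
  split_ifs with h0 h1 h2 h3
  · have hx : a i j = 0 := by
      rcases mul_eq_zero.1 h0 with h | h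
      · exact h
      · exact ha.zero _ _ h
    obtain ⟨e1, e2⟩ := key 0 0 hx (ha.zero _ _ hx)
    ext1 v
    simp only [pow_succ, pow_zero, one_mul, LinearEquiv.mul_apply, reflLin_apply, map_sub,
      map_smul, hii, hjj, e1, e2, LinearEquiv.coe_one, id]
    module
  · have hx : a i j = -1 ∧ a j i = -1 := by
      rcases Int.mul_eq_one_iff_eq_one_or_neg_one.1 h1 with h | h
      · lia
      · exact h
    obtain ⟨e1, e2⟩ := key _ _ hx.1 hx.2
    ext1 v
    simp only [pow_succ, pow_zero, one_mul, LinearEquiv.mul_apply, reflLin_apply, map_sub,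
      map_smul, hii, hjj, e1, e2, LinearEquiv.coe_one, id]
    push_cast
    module
  · have b1 : -2 ≤ a i j := by
      rcases eq_or_ne (a j i) 0 with h | h
      · simp [h] at h0
      · have : a j i ≤ -1 := by lia
        nlinarith
    have b2 : -2 ≤ a j i := by
      rcases eq_or_ne (a i j) 0 with h | h
      · simp [h] at h0
      · have : a i j ≤ -1 := by lia
        nlinarith
    have hx : (a i j = -1 ∧ a j i = -2) ∨ (a i j = -2 ∧ a j i = -1) := by
      generalize a i j = x at *
      generalize a j i = y at *
      interval_cases x <;> interval_cases y <;> simp_all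
    rcases hx with hx | hx <;>
    · obtain ⟨e1, e2⟩ := key _ _ hx.1 hx.2
      ext1 v
      simp only [pow_succ, pow_zero, one_mul, LinearEquiv.mul_apply, reflLin_apply, map_sub,
        map_smul, hii, hjj, e1, e2, LinearEquiv.coe_one, id]
      push_cast
      module
  · have b1 : -3 ≤ a i j := by
      rcases eq_or_ne (a j i) 0 with h | h
      · simp [h] at h0
      · have : a j i ≤ -1 := by lia
        nlinarith
    have b2 : -3 ≤ a j i := by
      rcases eq_or_ne (a i j) 0 with h | h
      · simp [h] at h0
      · have : a i j ≤ -1 := by lia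
        nlinarith
    have hx : (a i j = -1 ∧ a j i = -3) ∨ (a i j = -3 ∧ a j i = -1) := by
      generalize a i j = x at *
      generalize a j i = y at *
      interval_cases x <;> interval_cases y <;> simp_all
    rcases hx with hx | hx <;>
    · obtain ⟨e1, e2⟩ := key _ _ hx.1 hx.2
      have h6 : ∀ v, ((reflLin ha i * reflLin ha j) ^ 3) v =
          v + (-4 * coroot a i v + 2 * coroot a i (root j) * coroot a j v) • root i
            + (-4 * coroot a j v + 2 * coroot a j (root i) * coroot a i v) • root j := by
        intro v
        simp only [pow_succ, pow_zero, one_mul, LinearEquiv.mul_apply, reflLin_apply, map_sub,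
          map_smul, hii, hjj, e1, e2]
        push_cast
        module
      rw [show 6 = 3 + 3 from rfl, pow_add]
      ext1 v
      rw [LinearEquiv.mul_apply, h6, h6]
      simp only [map_add, map_smul, hii, hjj, e1, e2, smul_eq_mul, LinearEquiv.coe_one, id]
      push_cast
      module
  · rfl

/-- The action of the Weyl group on `V`, in which `s j` acts as the reflection along `α j`. -/
noncomputable def weylRep {a : Matrix B B ℤ} (ha : IsCartan a) :
    WeylGroup a →* ((B → ℝ) ≃ₗ[ℝ] (B → ℝ)) :=
  (coxeterMatrix a).toCoxeterSystem.lift ⟨reflLin ha, reflLin_isLiftable ha⟩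

theorem weylRep_simple {a : Matrix B B ℤ} (ha : IsCartan a) (j : B) :
    weylRep ha ((coxeterMatrix a).simple j) = reflLin ha j :=
  (coxeterMatrix a).toCoxeterSystem.lift_apply_simple (reflLin_isLiftable ha) j

/-- A permutation of the nodes acts on `V` by permuting the simple roots. -/
def permRep : Equiv.Perm B →* ((B → ℝ) ≃ₗ[ℝ] (B → ℝ)) where
  toFun e := LinearEquiv.funCongrLeft ℝ ℝ e⁻¹
  map_one' := rfl
  map_mul' _ _ := rfl

theorem permRep_root (e : Equiv.Perm B) (i : B) : permRep e (root i) = root (e i) := by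
  ext k
  change root i (e⁻¹ k) = root (e i) k
  rw [root, root, Pi.single_apply, Pi.single_apply]
  simp only [Equiv.Perm.inv_eq_iff_eq]

/-- The action of the extended group on `V`. -/
noncomputable def extRep {a : Matrix B B ℤ} (ha : IsCartan a) (σ : diagramAut a) :
    ExtendedWeylGroup a σ →* ((B → ℝ) ≃ₗ[ℝ] (B → ℝ)) :=
  SemidirectProduct.lift (weylRep ha)
    (permRep.comp ((diagramAut a).subtype.comp (Subgroup.zpowers σ).subtype)) (by
      intro g
      refine weylGroup_hom_ext a fun j => ?_
      have h1 : (((autAction a).comp (Subgroup.zpowers σ).subtype) g)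
          ((coxeterMatrix a).simple j) = (coxeterMatrix a).simple (g.1.1 j) :=
        autHom_simple a g.1 j
      simp only [MonoidHom.comp_apply, MulEquiv.coe_toMonoidHom, MulAut.conj_apply]
      erw [h1]
      rw [weylRep_simple, weylRep_simple, eq_mul_inv_iff_mul_eq]
      refine LinearEquiv.toLinearMap_injective (LinearMap.pi_ext' fun i => ?_)
      ext1
      change reflLin ha _ (permRep g.1.1 (root i)) = permRep g.1.1 (reflLin ha j (root i))
      rw [permRep_root, reflLin_root, reflLin_root, map_sub, map_smul, permRep_root,
        permRep_root, g.1.2 i j])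

theorem extRep_refl {a : Matrix B B ℤ} (ha : IsCartan a) (σ : diagramAut a) (i j : B) :
    extRep ha σ (simpleRefl a σ j) (root i) = root i - (a i j : ℝ) • root j := by
  rw [extRep, simpleRefl, SemidirectProduct.lift_inl, weylRep_simple, reflLin_root]

theorem extRep_diag {a : Matrix B B ℤ} (ha : IsCartan a) (σ : diagramAut a) (i : B) :
    extRep ha σ (diagGen a σ) (root i) = root (σ.1 i) := by
  rw [extRep, diagGen, SemidirectProduct.lift_inr]
  exact permRep_root _ _

/-- The standard parabolic subgroup `W_J`, generated by the simple reflections along the simple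
roots in `J`. -/
def parabolic (a : Matrix B B ℤ) (σ : diagramAut a) (J : Set (B → ℝ)) :
    Subgroup (ExtendedWeylGroup a σ) :=
  Subgroup.closure {g | ∃ i, root i ∈ J ∧ g = simpleRefl a σ i}

/-- The subgroup `N_J` of the elements `w` with `w J = J`. -/
noncomputable def setStabilizer {a : Matrix B B ℤ} (ha : IsCartan a) (σ : diagramAut a)
    (J : Set (B → ℝ)) : Subgroup (ExtendedWeylGroup a σ) where
  carrier := {w | extRep ha σ w '' J = J}
  one_mem' := by simp
  mul_mem' := by
    intro x y hx hy
    simp only [Set.mem_ofPred_eq] at *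
    have : ⇑(extRep ha σ (x * y)) = extRep ha σ x ∘ extRep ha σ y := by
      rw [map_mul]; rfl
    rw [this, Set.image_comp, hy, hx]
  inv_mem' := by
    intro x hx
    simp only [Set.mem_ofPred_eq] at *
    conv_lhs => rw [← hx]
    rw [← Set.image_comp]
    have : extRep ha σ x⁻¹ ∘ extRep ha σ x = id := by
      ext1 v
      change (extRep ha σ x⁻¹ * extRep ha σ x) v = v
      rw [← map_mul, inv_mul_cancel, map_one]; rfl
    rw [this, Set.image_id]

end General

/-- The subgroup `G` is the internal semidirect product `H ⋉ N` of its subgroups `H` and `N`, with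
`N` normal in `G`. -/
structure IsInternalSemidirect {K : Type} [Group K] (G H N : Subgroup K) : Prop where
  normal : G ≤ Subgroup.normalizer (N : Set K)
  sup_eq : H ⊔ N = G
  inf_eq : H ⊓ N = ⊥

/-! ### Type `E₇⁽¹⁾` -/

/-- The entries of the Cartan matrix of type `E₇⁽¹⁾`, the index set
being `{0, 1, …, 7}` in Bourbaki's numbering:
the diagram is the chain `0 — 1 — 3 — 4 — 5 — 6 — 7` with `2` attached to `4`. -/
def entriesE7 : Fin 8 → Fin 8 → ℤ :=
  ![![2, -1,  0,  0,  0,  0,  0,  0],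
    ![-1,  2,  0, -1,  0,  0,  0,  0],
    ![0,  0,  2,  0, -1,  0,  0,  0],
    ![0, -1,  0,  2, -1,  0,  0,  0],
    ![0,  0, -1, -1,  2, -1,  0,  0],
    ![0,  0,  0,  0, -1,  2, -1,  0],
    ![0,  0,  0,  0,  0, -1,  2, -1],
    ![0,  0,  0,  0,  0,  0, -1,  2]]

/-- The Cartan matrix of type `E₇⁽¹⁾`. -/
def cartanE7 : Matrix (Fin 8) (Fin 8) ℤ := Matrix.of entriesE7

theorem isCartan_E7 : IsCartan cartanE7 :=
  ⟨(by decide : ∀ i : Fin 8, entriesE7 i i = 2),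
    (by decide : ∀ i j : Fin 8, i ≠ j → entriesE7 i j ≤ 0),
    (by decide : ∀ i j : Fin 8, entriesE7 i j = 0 → entriesE7 j i = 0)⟩

/-- The permutation `(0 7)(1 6)(3 5)`. -/
def permE7 : Equiv.Perm (Fin 8) := Equiv.swap 0 7 * Equiv.swap 1 6 * Equiv.swap 3 5

/-- The diagram automorphism `(0 7)(1 6)(3 5)` of `E₇⁽¹⁾`. -/
def sigmaPermE7 : diagramAut cartanE7 :=
  ⟨permE7, mem_diagramAut.2
    (by decide : ∀ i j : Fin 8, entriesE7 (permE7 i) (permE7 j) = entriesE7 i j)⟩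

/-- The extended affine Weyl group of type `E₇⁽¹⁾`. -/
abbrev WE7 : Type := ExtendedWeylGroup cartanE7 sigmaPermE7

/-- The simple reflections of the extended affine Weyl group of type `E₇⁽¹⁾`. -/
def s (i : Fin 8) : WE7 := simpleRefl cartanE7 sigmaPermE7 i

/-- The generator `σ` of the extended affine Weyl group of type `E₇⁽¹⁾`. -/
def σ : WE7 := diagGen cartanE7 sigmaPermE7

/-- `J = {α₀, α₃, α₅, α₇}`. -/
def J : Set (Fin 8 → ℝ) := {root 0, root 3, root 5, root 7}

/-- The indices of the four elements of `J`. -/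
def indexJ : Fin 4 → Fin 8 := ![0, 3, 5, 7]

/-- The parabolic subgroup `W_J`. -/
def WJ : Subgroup WE7 := parabolic cartanE7 sigmaPermE7 J

/-- The subgroup `N_J` of all `w` with `w J = J`. -/
noncomputable def NJ : Subgroup WE7 := setStabilizer isCartan_E7 sigmaPermE7 J

/-- The elements `b₀ = s₁s₃s₀s₁`, `b₁ = s₆s₅s₇s₆`, `b₂ = s₄s₅s₃s₄`, `b₃ = s₂`. -/
def b : Fin 4 → WE7 :=
  ![s 1 * s 3 * s 0 * s 1, s 6 * s 5 * s 7 * s 6, s 4 * s 5 * s 3 * s 4, s 2]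

/-! ### Types `B₃⁽¹⁾` and `4A₁` -/

/-- The entries of the Cartan matrix of type `B₃⁽¹⁾`, the index set
being `{0, 1, 2, 3}`: the nodes `0` and `1` are
joined to `2` by single bonds, and `2` is joined to the short root `3` by a double bond. -/
def entriesB3 : Fin 4 → Fin 4 → ℤ :=
  ![![2,  0, -1,  0],
    ![0,  2, -1,  0],
    ![-1, -1,  2, -2],
    ![0,  0, -1,  2]]

/-- The Cartan matrix of type `B₃⁽¹⁾`. -/
def cartanB3 : Matrix (Fin 4) (Fin 4) ℤ := Matrix.of entriesB3

/-- The diagram automorphism of `B₃⁽¹⁾` that exchanges `0` and `1`. -/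
def sigmaPermB3 : diagramAut cartanB3 :=
  ⟨Equiv.swap 0 1,
    mem_diagramAut.2 (by decide : ∀ i j : Fin 4,
      entriesB3 ((Equiv.swap 0 1 : Equiv.Perm (Fin 4)) i)
        ((Equiv.swap 0 1 : Equiv.Perm (Fin 4)) j) = entriesB3 i j)⟩

/-- The extended affine Weyl group of type `B₃⁽¹⁾`. -/
abbrev WB3 : Type := ExtendedWeylGroup cartanB3 sigmaPermB3

/-- The Cartan matrix of type `4A₁`. -/
def cartan4A1 : Matrix (Fin 4) (Fin 4) ℤ := Matrix.diagonal fun _ => 2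

/-- The Weyl group of type `4A₁`. -/
abbrev W4A1 : Type := WeylGroup cartan4A1

end AffineWeyl

/-! Everything rests on the action on the space `V` of the simple roots. When all bonds are at most
double, `w α_i` is nonnegative or nonpositive according as `s i` lengthens or shortens `w`
(`weylRep_root_nonneg`, `weylRep_root_nonpos`). So only the identity of the Weyl group keeps all
simple roots nonnegative, the extended group acts faithfully (`extRep_injective`), and identities in
it can be checked on simple roots.

If `g` normalises `W_J`, then conjugation carries the reflection in a root `α` of `J` to an element
of `W_J`, which forces `g α = ±β` with `β` in `J` (`exists_rep_root_of_mem_normalizer`). As `W_J`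
contains every sign change on `J` and only its identity preserves `J`, the normaliser is `N_J ⋉
W_J`.

The nodes outside `J` are 1, 6, 4, 2, and the elements `b 0`, `b 1`, `b 2`, `b 3` are the quotients
`w_{J ∪ {i}} w_J` of longest elements for these nodes. If `w` in `N_J ∩ W` has a descent `i`, then
`i` lies outside `J`, and `w α_i` has a negative coordinate outside `J`. Adding images of roots of
`J` does not change that coordinate, so multiplying by the matching `b k` shortens `w`
(`exists_b_len_lt`). Hence `N_J ∩ W` is generated by the `b k`, and `σ` accounts for the rest of
`N_J`.

The `b k` and `σ` satisfy the relations of the extended group of type `B₃⁽¹⁾`, which therefore maps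
onto `N_J`. Modulo the span of `J` they act as its generators do in the reflection representation;
that representation is faithful, so the map is injective (`homB_injective`). -/

namespace AffineWeyl

/-! ### Signs of images of simple roots, and faithfulness of the action -/

section General

variable {B : Type} [DecidableEq B]

theorem toCoxeterSystem_simple (a : Matrix B B ℤ) (i : B) :
    (coxeterMatrix a).toCoxeterSystem.simple i = (coxeterMatrix a).simple i := rfl

theorem simple_mul_self (a : Matrix B B ℤ) (i : B) :
    (coxeterMatrix a).simple i * (coxeterMatrix a).simple i = 1 :=
  (coxeterMatrix a).toCoxeterSystem.simple_mul_simple_self i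

theorem exists_eq_mul_simple (a : Matrix B B ℤ) (w : WeylGroup a) (i : B) :
    ∃ u, w = u * (coxeterMatrix a).simple i :=
  ⟨w * (coxeterMatrix a).simple i, by rw [mul_assoc, simple_mul_self, mul_one]⟩

/-- The word length on the Weyl group. -/
noncomputable def len (a : Matrix B B ℤ) (w : WeylGroup a) : ℕ :=
  (coxeterMatrix a).toCoxeterSystem.length w

theorem len_mul_simple (a : Matrix B B ℤ) (w : WeylGroup a) (i : B) :
    len a (w * (coxeterMatrix a).simple i) = len a w + 1 ∨
      len a (w * (coxeterMatrix a).simple i) + 1 = len a w :=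
  (coxeterMatrix a).toCoxeterSystem.length_mul_simple w i

theorem exists_descent (a : Matrix B B ℤ) {w : WeylGroup a} (hw : w ≠ 1) :
    ∃ i, len a (w * (coxeterMatrix a).simple i) < len a w :=
  (coxeterMatrix a).toCoxeterSystem.exists_rightDescent_of_ne_one hw

theorem simple_commute {a : Matrix B B ℤ} {i j : B} (hij : i ≠ j) (h : a i j * a j i = 0) :
    (coxeterMatrix a).simple i * (coxeterMatrix a).simple j =
      (coxeterMatrix a).simple j * (coxeterMatrix a).simple i := by
  have h1 := (coxeterMatrix a).toCoxeterSystem.simple_mul_simple_pow i j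
  have hm : coxeterMatrix a i j = 2 := by simp [coxeterMatrix, hij, h, -mul_eq_zero]
  rw [hm, toCoxeterSystem_simple, toCoxeterSystem_simple] at h1
  have hi := simple_mul_self a i
  have hj := simple_mul_self a j
  generalize (coxeterMatrix a).simple i = x at *
  generalize (coxeterMatrix a).simple j = y at *
  have hx : x⁻¹ = x := inv_eq_of_mul_eq_one_left hi
  have hy : y⁻¹ = y := inv_eq_of_mul_eq_one_left hj
  have h2 : x * y * (x * y) = 1 := by simpa [pow_succ] using h1
  have := eq_inv_of_mul_eq_one_left h2
  simpa [hx, hy] using this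

theorem simple_braid_three {a : Matrix B B ℤ} {i j : B} (hij : i ≠ j) (h : a i j * a j i = 1) :
    (coxeterMatrix a).simple i * (coxeterMatrix a).simple j * (coxeterMatrix a).simple i =
      (coxeterMatrix a).simple j * (coxeterMatrix a).simple i * (coxeterMatrix a).simple j := by
  have h1 := (coxeterMatrix a).toCoxeterSystem.simple_mul_simple_pow i j
  have hm : coxeterMatrix a i j = 3 := by simp [coxeterMatrix, hij, h, -mul_eq_zero]
  rw [hm, toCoxeterSystem_simple, toCoxeterSystem_simple] at h1
  have hi := simple_mul_self a i
  have hj := simple_mul_self a j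
  generalize (coxeterMatrix a).simple i = x at *
  generalize (coxeterMatrix a).simple j = y at *
  have hx : x⁻¹ = x := inv_eq_of_mul_eq_one_left hi
  have hy : y⁻¹ = y := inv_eq_of_mul_eq_one_left hj
  have h2 : x * y * x * (y * x * y) = 1 := by simpa [pow_succ, mul_assoc] using h1
  have := eq_inv_of_mul_eq_one_left h2
  simpa [hx, hy, mul_assoc] using this

theorem simple_braid_four {a : Matrix B B ℤ} {i j : B} (hij : i ≠ j) (h : a i j * a j i = 2) :
    (coxeterMatrix a).simple i * (coxeterMatrix a).simple j * (coxeterMatrix a).simple i *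
        (coxeterMatrix a).simple j =
      (coxeterMatrix a).simple j * (coxeterMatrix a).simple i * (coxeterMatrix a).simple j *
        (coxeterMatrix a).simple i := by
  have h1 := (coxeterMatrix a).toCoxeterSystem.simple_mul_simple_pow i j
  have hm : coxeterMatrix a i j = 4 := by simp [coxeterMatrix, hij, h, -mul_eq_zero]
  rw [hm, toCoxeterSystem_simple, toCoxeterSystem_simple] at h1
  have hi := simple_mul_self a i
  have hj := simple_mul_self a j
  generalize (coxeterMatrix a).simple i = x at *
  generalize (coxeterMatrix a).simple j = y at *
  have hx : x⁻¹ = x := inv_eq_of_mul_eq_one_left hi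
  have hy : y⁻¹ = y := inv_eq_of_mul_eq_one_left hj
  have h2 : x * y * x * y * (x * y * x * y) = 1 := by simpa [pow_succ, mul_assoc] using h1
  have := eq_inv_of_mul_eq_one_left h2
  simpa [hx, hy, mul_assoc] using this

theorem root_nonneg (i : B) : 0 ≤ (root i : B → ℝ) := by
  rw [root, Pi.single_nonneg]; exact zero_le_one

theorem root_ne_zero (i : B) : (root i : B → ℝ) ≠ 0 := by
  rw [root, Ne, Pi.single_eq_zero_iff]; exact one_ne_zero

theorem root_injective : Function.Injective (root : B → B → ℝ) := by
  intro i j h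
  by_contra hij
  have := congrFun h i
  simp [root, hij] at this

variable [Fintype B]

theorem weylRep_mul_simple_root {a : Matrix B B ℤ} (ha : IsCartan a) (w : WeylGroup a) (i j : B) :
    weylRep ha (w * (coxeterMatrix a).simple j) (root i) =
      weylRep ha w (root i) - (a i j : ℝ) • weylRep ha w (root j) := by
  rw [map_mul, LinearEquiv.mul_apply, weylRep_simple, reflLin_root, map_sub, map_smul]

/-- The Cartan matrices all of whose bonds are at most double bonds. -/
def AtMostDouble (a : Matrix B B ℤ) : Prop := ∀ i j, i ≠ j → a i j * a j i ≤ 2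

/-- If right multiplication by a simple reflection increases the length of `w`, then `w` maps the
simple root to a nonnegative vector. -/
theorem weylRep_root_nonneg {a : Matrix B B ℤ} (ha : IsCartan a) (h2 : AtMostDouble a)
    (w : WeylGroup a) (i : B) (hw : len a w < len a (w * (coxeterMatrix a).simple i)) :
    0 ≤ weylRep ha w (root i) := by
  induction hn : len a w using Nat.strong_induction_on generalizing w i with
  | _ n ih =>
  subst hn
  by_cases h1 : w = 1
  · subst h1; simpa using root_nonneg i
  -- Letters `s j`, `s i`, `s j`, `s i` are stripped alternately from the right end of `w` as long
  -- as they are descents. Once both letters lengthen the remaining factor `u`, induction applies to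
  -- `u α_i` and `u α_j`, of which `w α_i` is a nonnegative combination. Otherwise the stripped word
  -- becomes the longest element of the dihedral group, and a braid relation contradicts the
  -- assumption that `s i` lengthens `w`. With at most double bonds this takes no more than four
  -- letters.
  obtain ⟨j, hj⟩ := exists_descent a h1
  have hij : i ≠ j := by rintro rfl; omega
  obtain ⟨w, rfl⟩ := exists_eq_mul_simple a w j
  have si := simple_mul_self a i
  have sj := simple_mul_self a j
  have nij := ha.nonpos i j hij
  have nji := ha.nonpos j i hij.symm
  have hpq : a i j * a j i = 0 ∨ a i j * a j i = 1 ∨ a i j * a j i = 2 := by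
    have := h2 i j hij
    have : 0 ≤ a i j * a j i := by nlinarith
    omega
  have hp : (0 : ℝ) ≤ -(a i j : ℝ) := by exact_mod_cast neg_nonneg.2 nij
  have hlen := len_mul_simple a
  have dii := ha.diag i
  have djj := ha.diag j
  have comm := fun h => simple_commute (a := a) hij h
  have braid3 := fun h => simple_braid_three (a := a) hij h
  have braid4 := fun h => simple_braid_four (a := a) hij h
  have act := fun w k l => weylRep_mul_simple_root ha w k l
  generalize hI : (coxeterMatrix a).simple i = I at *
  generalize hJ : (coxeterMatrix a).simple j = K at *
  have li : ∀ w, len a (w * I) = len a w + 1 ∨ len a (w * I) + 1 = len a w :=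
    fun w => hI ▸ hlen w i
  have lj : ∀ w, len a (w * K) = len a w + 1 ∨ len a (w * K) + 1 = len a w :=
    fun w => hJ ▸ hlen w j
  have cancel_i : ∀ w : WeylGroup a, w * I * I = w := fun w => by rw [mul_assoc, si, mul_one]
  have cancel_j : ∀ w : WeylGroup a, w * K * K = w := fun w => by rw [mul_assoc, sj, mul_one]
  have ihi : ∀ u, len a u < len a (w * K) → len a u < len a (u * I) →
      0 ≤ weylRep ha u (root i) := fun u hu hI' => ih _ hu u i (by rwa [hI]) rfl
  have ihj : ∀ u, len a u < len a (w * K) → len a u < len a (u * K) →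
      0 ≤ weylRep ha u (root j) := fun u hu hK' => ih _ hu u j (by rwa [hJ]) rfl
  have acti : ∀ u k, weylRep ha (u * I) (root k) =
      weylRep ha u (root k) - (a k i : ℝ) • weylRep ha u (root i) := fun u k => hI ▸ act u k i
  have actj : ∀ u k, weylRep ha (u * K) (root k) =
      weylRep ha u (root k) - (a k j : ℝ) • weylRep ha u (root j) := fun u k => hJ ▸ act u k j
  rw [cancel_j] at hj
  by_cases hA : len a w < len a (w * I)
  · have e1 := ihi w hj hA
    have e2 := ihj w hj hj
    rw [actj, sub_eq_add_neg, ← neg_smul]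
    exact add_nonneg e1 (smul_nonneg hp e2)
  obtain ⟨w, rfl⟩ : ∃ u, w = u * I := ⟨w * I, (cancel_i w).symm⟩
  rw [cancel_i] at hA
  have := li w
  have b1 := lj (w * I)
  have b2 := li (w * I * K)
  rcases hpq with h | hpq
  · have e : w * I * K * I = w * K := by
      rw [mul_assoc w I K, comm h, ← mul_assoc, cancel_i]
    rw [e] at hw
    have := lj w
    omega
  by_cases hB : len a w < len a (w * K)
  · have e1 := ihi w (by omega) (by omega)
    have e2 := ihj w (by omega) hB
    have : weylRep ha (w * I * K) (root i) =
        ((a i j : ℝ) * a j i - 1) • weylRep ha w (root i)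
          + (-(a i j : ℝ)) • weylRep ha w (root j) := by
      rw [actj, acti, acti, dii]; push_cast; module
    rw [this]
    refine add_nonneg (smul_nonneg ?_ e1) (smul_nonneg hp e2)
    have : 1 ≤ a i j * a j i := by omega
    have : (1 : ℝ) ≤ (a i j : ℝ) * a j i := by exact_mod_cast this
    linarith
  obtain ⟨w, rfl⟩ : ∃ u, w = u * K := ⟨w * K, (cancel_j w).symm⟩
  rw [cancel_j] at hB
  have b3 := lj w
  rcases hpq with h | h
  · have e : w * K * I * K * I = w * I * K := by
      rw [mul_assoc w K I, mul_assoc w, ← braid3 h, ← mul_assoc, ← mul_assoc, cancel_i]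
    rw [e] at hw
    have := lj (w * I)
    have := li w
    omega
  have hR : (a i j : ℝ) * a j i = 2 := by exact_mod_cast h
  by_cases hC : len a w < len a (w * I)
  · have e1 := ihi w (by omega) hC
    have : weylRep ha (w * K * I * K) (root i) = ((a i j : ℝ) * a j i - 1) • weylRep ha w (root i)
        + ((a i j : ℝ) * (2 - a i j * a j i)) • weylRep ha w (root j) := by
      rw [actj, acti, acti, actj, actj, dii, djj]; push_cast; module
    rw [this, hR]
    simpa using smul_nonneg (by norm_num) e1
  obtain ⟨w, rfl⟩ : ∃ u, w = u * I := ⟨w * I, (cancel_i w).symm⟩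
  rw [cancel_i] at hC
  have e : w * I * K * I * K * I = w * K * I * K := by
    have : w * I * K * I * K = w * (I * K * I * K) := by simp only [mul_assoc]
    rw [this, braid4 h]
    simp only [← mul_assoc, cancel_i]
  rw [e] at hw
  have := li w
  have := lj (w * K * I)
  have := li (w * K)
  have := lj w
  omega

/-- If right multiplication by a simple reflection decreases the length of `w`, then `w` maps the
simple root to a nonpositive vector. -/
theorem weylRep_root_nonpos {a : Matrix B B ℤ} (ha : IsCartan a) (h2 : AtMostDouble a)
    (w : WeylGroup a) (i : B) (hw : len a (w * (coxeterMatrix a).simple i) < len a w) :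
    weylRep ha w (root i) ≤ 0 := by
  obtain ⟨u, rfl⟩ := exists_eq_mul_simple a w i
  rw [mul_assoc, simple_mul_self, mul_one] at hw
  have h := weylRep_root_nonneg ha h2 u i hw
  rw [weylRep_mul_simple_root, ha.diag, ← sub_nonneg]
  convert h using 1
  push_cast
  module

theorem weylRep_root_ne_zero {a : Matrix B B ℤ} (ha : IsCartan a) (w : WeylGroup a) (i : B) :
    weylRep ha w (root i) ≠ 0 := by
  rw [Ne, LinearEquiv.map_eq_zero_iff]; exact root_ne_zero i

/-- Right multiplication by a simple reflection decreases the length of `w` if the image of the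
simple root has a negative coordinate. -/
theorem len_mul_simple_lt {a : Matrix B B ℤ} (ha : IsCartan a) (h2 : AtMostDouble a)
    (w : WeylGroup a) (i k : B) (hk : weylRep ha w (root i) k < 0) :
    len a (w * (coxeterMatrix a).simple i) < len a w := by
  by_contra h
  have := weylRep_root_nonneg ha h2 w i (by have := len_mul_simple a w i; omega) k
  simp only [Pi.zero_apply] at this
  linarith

/-- A nontrivial `w` has a descent `i`; then `w α_i` is both nonpositive and nonnegative, hence
zero, which is impossible for an invertible map. -/
theorem eq_one_of_weylRep_nonneg {a : Matrix B B ℤ} (ha : IsCartan a) (h2 : AtMostDouble a)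
    (w : WeylGroup a) (hw : ∀ i, 0 ≤ weylRep ha w (root i)) : w = 1 := by
  by_contra h
  obtain ⟨i, hi⟩ := exists_descent a h
  exact weylRep_root_ne_zero ha w i (le_antisymm (weylRep_root_nonpos ha h2 w i hi) (hw i))

theorem weylRep_injective {a : Matrix B B ℤ} (ha : IsCartan a) (h2 : AtMostDouble a) :
    Function.Injective (weylRep ha) :=
  (injective_iff_map_eq_one _).2 fun w hw =>
    eq_one_of_weylRep_nonneg ha h2 w fun i => by simpa [hw] using root_nonneg i

theorem extRep_inl {a : Matrix B B ℤ} (ha : IsCartan a) (σ : diagramAut a) (w : WeylGroup a) :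
    extRep ha σ (SemidirectProduct.inl w) = weylRep ha w := by
  rw [extRep, SemidirectProduct.lift_inl]

theorem extRep_inr {a : Matrix B B ℤ} (ha : IsCartan a) (σ : diagramAut a)
    (t : Subgroup.zpowers σ) (i : B) :
    extRep ha σ (SemidirectProduct.inr t) (root i) = root (t.1.1 i) := by
  rw [extRep, SemidirectProduct.lift_inr]
  exact permRep_root _ _

theorem extRep_mul_apply {a : Matrix B B ℤ} (ha : IsCartan a) (σ : diagramAut a)
    (x y : ExtendedWeylGroup a σ) (v : B → ℝ) :
    extRep ha σ (x * y) v = extRep ha σ x (extRep ha σ y v) := by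
  rw [map_mul]; rfl

/-- If `w t` acts trivially, with `t` a power of the diagram automorphism, then `w` sends simple
roots to simple roots, so `w = 1`; then `t` fixes every node. -/
theorem extRep_injective {a : Matrix B B ℤ} (ha : IsCartan a) (h2 : AtMostDouble a)
    (σ : diagramAut a) : Function.Injective (extRep ha σ) := by
  refine (injective_iff_map_eq_one _).2 fun g hg => ?_
  obtain ⟨w, t⟩ := g
  have hg' : ∀ v, weylRep ha w (extRep ha σ (SemidirectProduct.inr t) v) = v := by
    intro v
    rw [← extRep_inl ha σ w, ← extRep_mul_apply, ← SemidirectProduct.mk_eq_inl_mul_inr, hg]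
    rfl
  have hw : w = 1 := by
    refine eq_one_of_weylRep_nonneg ha h2 w fun i => ?_
    have h := hg' (root (t.1.1⁻¹ i))
    rw [extRep_inr] at h
    have e : t.1.1 (t.1.1⁻¹ i) = i := by simp
    rw [e] at h
    rw [h]
    exact root_nonneg _
  subst hw
  have ht : t = 1 := by
    refine Subtype.ext (Subtype.ext (Equiv.ext fun i => ?_))
    have h := hg' (root i)
    rw [extRep_inr, map_one] at h
    exact root_injective h
  subst ht
  rfl

theorem linearEquiv_ext_root {f g : (B → ℝ) ≃ₗ[ℝ] (B → ℝ)}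
    (h : ∀ i, f (root i) = g (root i)) : f = g := by
  refine LinearEquiv.toLinearMap_injective (LinearMap.pi_ext' fun i => ?_)
  ext1
  exact h i

theorem ext_of_root {a : Matrix B B ℤ} (ha : IsCartan a) (h2 : AtMostDouble a) (σ : diagramAut a)
    {x y : ExtendedWeylGroup a σ} (h : ∀ i, extRep ha σ x (root i) = extRep ha σ y (root i)) :
    x = y :=
  extRep_injective ha h2 σ (linearEquiv_ext_root h)

end General

/-! ### The invariant form of a symmetric Cartan matrix -/

section Form

variable {B : Type} [DecidableEq B] [Fintype B]

/-- The bilinear form on `V` whose Gram matrix on the simple roots is the Cartan matrix. -/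
noncomputable def form (a : Matrix B B ℤ) : LinearMap.BilinForm ℝ (B → ℝ) :=
  Matrix.toBilin' (a.map (Int.cast : ℤ → ℝ))

theorem form_apply (a : Matrix B B ℤ) (u v : B → ℝ) :
    form a u v = ∑ i, ∑ j, u i * a i j * v j := by
  simp [form, Matrix.toBilin'_apply]

theorem form_root_right (a : Matrix B B ℤ) (u : B → ℝ) (k : B) :
    form a u (root k) = coroot a k u := by
  simp [form_apply, coroot, root, Pi.single_apply, mul_comm]

theorem form_comm {a : Matrix B B ℤ} (hs : a.IsSymm) (u v : B → ℝ) :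
    form a u v = form a v u := by
  rw [form_apply, form_apply, Finset.sum_comm]
  refine Finset.sum_congr rfl fun i _ => Finset.sum_congr rfl fun j _ => ?_
  rw [hs.apply i j]
  ring

theorem form_reflLin {a : Matrix B B ℤ} (ha : IsCartan a) (hs : a.IsSymm) (k : B) (u v : B → ℝ) :
    form a (reflLin ha k u) (reflLin ha k v) = form a u v := by
  have hk : form a (root k) (root k) = 2 := by
    rw [form_root_right, coroot_root, ha.diag]; norm_num
  have hv : form a (root k) v = coroot a k v := by rw [form_comm hs, form_root_right]
  rw [reflLin_apply, reflLin_apply]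
  simp only [map_sub, map_smul, LinearMap.sub_apply, LinearMap.smul_apply, hk, hv,
    form_root_right, smul_eq_mul]
  ring

theorem form_permRep {a : Matrix B B ℤ} {e : Equiv.Perm B} (he : e ∈ diagramAut a)
    (u v : B → ℝ) : form a (permRep e u) (permRep e v) = form a u v := by
  rw [form_apply, form_apply, ← Equiv.sum_comp e]
  refine Finset.sum_congr rfl fun i _ => ?_
  rw [← Equiv.sum_comp e]
  refine Finset.sum_congr rfl fun j _ => ?_
  rw [mem_diagramAut.1 he]
  change u (e⁻¹ (e i)) * _ * v (e⁻¹ (e j)) = _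
  simp

theorem form_extRep {a : Matrix B B ℤ} (ha : IsCartan a) (hs : a.IsSymm) (σ : diagramAut a)
    (g : ExtendedWeylGroup a σ) (u v : B → ℝ) :
    form a (extRep ha σ g u) (extRep ha σ g v) = form a u v := by
  obtain ⟨w, t⟩ := g
  have hw : ∀ u v, form a (weylRep ha w u) (weylRep ha w v) = form a u v := by
    refine (coxeterMatrix a).toCoxeterSystem.simple_induction
      (p := fun w => ∀ u v, form a (weylRep ha w u) (weylRep ha w v) = form a u v) w
      (fun i u v => ?_) (fun u v => by rw [map_one]; rfl) (fun w w' h h' u v => ?_)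
    · rw [toCoxeterSystem_simple, weylRep_simple, form_reflLin ha hs]
    · rw [map_mul, LinearEquiv.mul_apply, LinearEquiv.mul_apply, h, h']
  rw [SemidirectProduct.mk_eq_inl_mul_inr, extRep_mul_apply, extRep_mul_apply, extRep_inl, hw,
    extRep, SemidirectProduct.lift_inr]
  exact form_permRep t.1.2 u v

/-- For a symmetric Cartan matrix a simple coroot is the pairing with its simple root under the
invariant form, so coroots are transported along with roots. -/
theorem coroot_eq_of_extRep_root {a : Matrix B B ℤ} (ha : IsCartan a) (hs : a.IsSymm)
    (σ : diagramAut a) {g : ExtendedWeylGroup a σ} {i j : B}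
    (h : extRep ha σ g (root i) = root j) (v : B → ℝ) :
    coroot a j (extRep ha σ g v) = coroot a i v := by
  rw [← form_root_right, ← form_root_right, ← h, form_extRep ha hs]

theorem extRep_simpleRefl_apply {a : Matrix B B ℤ} (ha : IsCartan a) (σ : diagramAut a) (j : B)
    (v : B → ℝ) : extRep ha σ (simpleRefl a σ j) v = v - coroot a j v • root j := by
  rw [simpleRefl, extRep_inl, weylRep_simple, reflLin_apply]

/-- An element that maps a simple root to a simple root conjugates the corresponding simple
reflections into each other. -/
theorem mul_simpleRefl_of_extRep_root {a : Matrix B B ℤ} (ha : IsCartan a) (h2 : AtMostDouble a)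
    (hs : a.IsSymm) (σ : diagramAut a) {g : ExtendedWeylGroup a σ} {i j : B}
    (h : extRep ha σ g (root i) = root j) :
    g * simpleRefl a σ i = simpleRefl a σ j * g := by
  refine ext_of_root ha h2 σ fun k => ?_
  rw [extRep_mul_apply, extRep_mul_apply, extRep_simpleRefl_apply, extRep_simpleRefl_apply,
    coroot_eq_of_extRep_root ha hs σ h, map_sub, map_smul, h]

end Form

/-! ### The elements `b k` and `σ` on the simple roots of `E₇⁽¹⁾`, and their relations -/

theorem atMostDouble_E7 : AtMostDouble cartanE7 :=
  (by decide : ∀ i j : Fin 8, i ≠ j → entriesE7 i j * entriesE7 j i ≤ 2)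

theorem isSymm_E7 : cartanE7.IsSymm :=
  Matrix.IsSymm.ext (by decide : ∀ i j : Fin 8, entriesE7 j i = entriesE7 i j)

/-- The action of the extended affine Weyl group of type `E₇⁽¹⁾` on `V`. -/
noncomputable abbrev rep : WE7 →* ((Fin 8 → ℝ) ≃ₗ[ℝ] (Fin 8 → ℝ)) :=
  extRep isCartan_E7 sigmaPermE7

theorem rep_mul (x y : WE7) (v : Fin 8 → ℝ) : rep (x * y) v = rep x (rep y v) :=
  extRep_mul_apply _ _ x y v

theorem rep_s (i j : Fin 8) : rep (s j) (root i) = root i - (entriesE7 i j : ℝ) • root j :=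
  extRep_refl _ _ i j

theorem rep_σ (i : Fin 8) : rep σ (root i) = root (permE7 i) := extRep_diag _ _ i

theorem rep_ext {x y : WE7} (h : ∀ i, rep x (root i) = rep y (root i)) : x = y :=
  ext_of_root isCartan_E7 atMostDouble_E7 sigmaPermE7 h

/-- This table and the next three reduce every relation among the `b k` to a check on eight simple
roots. On `J`, the elements `b 0`, `b 1`, `b 2` are the transpositions of `α₀, α₃`, of `α₅, α₇` and
of `α₃, α₅`, while `b 3` fixes every root. -/
theorem rep_b0 (i : Fin 8) : rep (b 0) (root i) =
    (![root 3, -(root 0 + root 1 + root 3), root 2, root 0, root 4 + root 3 + root 1, root 5,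
      root 6, root 7] : Fin 8 → Fin 8 → ℝ) i := by
  fin_cases i <;>
  · simp [b, -map_mul, rep_mul, rep_s, entriesE7]
    try module

theorem rep_b1 (i : Fin 8) : rep (b 1) (root i) =
    (![root 0, root 1, root 2, root 3, root 4 + root 5 + root 6, root 7,
      -(root 5 + root 6 + root 7), root 5] : Fin 8 → Fin 8 → ℝ) i := by
  fin_cases i <;>
  · simp [b, -map_mul, rep_mul, rep_s, entriesE7]
    try module

theorem rep_b2 (i : Fin 8) : rep (b 2) (root i) =
    (![root 0, root 1 + root 3 + root 4, root 2 + root 4 + root 4 + root 3 + root 5, root 5,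
      -(root 3 + root 4 + root 5), root 3, root 6 + root 5 + root 4, root 7] :
      Fin 8 → Fin 8 → ℝ) i := by
  fin_cases i <;>
  · simp [b, -map_mul, rep_mul, rep_s, entriesE7]
    try module

theorem rep_b3 (i : Fin 8) : rep (b 3) (root i) =
    (![root 0, root 1, -root 2, root 3, root 4 + root 2, root 5, root 6, root 7] :
      Fin 8 → Fin 8 → ℝ) i := by
  fin_cases i <;>
  · simp [b, rep_s, entriesE7]
    try module

theorem b_mul_self (k : Fin 4) : b k * b k = 1 := by
  refine rep_ext fun i => ?_
  fin_cases k <;> fin_cases i <;>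
  · simp [-map_mul, rep_mul, rep_b0, rep_b1, rep_b2, rep_b3]
    try abel

theorem b_pow_two : (b 0 * b 1) ^ 2 = 1 ∧ (b 0 * b 3) ^ 2 = 1 ∧ (b 1 * b 3) ^ 2 = 1 := by
  refine ⟨?_, ?_, ?_⟩ <;>
  · refine rep_ext fun i => ?_
    fin_cases i <;>
    · simp [-map_mul, -map_pow, pow_succ, rep_mul, rep_b0, rep_b1, rep_b3]
      try abel

theorem b_pow_three : (b 0 * b 2) ^ 3 = 1 ∧ (b 1 * b 2) ^ 3 = 1 := by
  refine ⟨?_, ?_⟩ <;>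
  · refine rep_ext fun i => ?_
    fin_cases i <;>
    · simp [-map_mul, -map_pow, pow_succ, rep_mul, rep_b0, rep_b1, rep_b2]
      try abel

theorem b_pow_four : (b 2 * b 3) ^ 4 = 1 := by
  refine rep_ext fun i => ?_
  fin_cases i <;>
  · simp [-map_mul, -map_pow, pow_succ, rep_mul, rep_b2, rep_b3]
    try abel

theorem σ_mul_self : σ * σ = 1 := by
  refine rep_ext fun i => ?_
  rw [rep_mul, rep_σ, rep_σ, map_one]
  exact congrArg root ((by decide : ∀ i, permE7 (permE7 i) = i) i)

theorem permE7_table (i : Fin 8) : permE7 i = (![7, 6, 2, 5, 4, 3, 1, 0] : Fin 8 → Fin 8) i :=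
  (by decide : ∀ i, permE7 i = (![7, 6, 2, 5, 4, 3, 1, 0] : Fin 8 → Fin 8) i) i

theorem σ_mul_b (k : Fin 4) : σ * b k = b (Equiv.swap 0 1 k) * σ := by
  have h : (Equiv.swap 0 1 : Equiv.Perm (Fin 4)) k = (![1, 0, 2, 3] : Fin 4 → Fin 4) k :=
    (by decide : ∀ k, (Equiv.swap 0 1 : Equiv.Perm (Fin 4)) k =
      (![1, 0, 2, 3] : Fin 4 → Fin 4) k) k
  rw [h]
  refine rep_ext fun i => ?_
  fin_cases k <;> fin_cases i <;>
  · simp [-map_mul, rep_mul, rep_b0, rep_b1, rep_b2, rep_b3, rep_σ, permE7_table]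
    try abel

/-! ### `W_J` as an embedded copy of `W(4A₁)` -/

theorem mem_J {v : Fin 8 → ℝ} : v ∈ J ↔ ∃ k, v = root (indexJ k) := by
  simp [J, Fin.exists_fin_succ, indexJ]

theorem J_eq_range : J = Set.range fun k => root (indexJ k) := by
  ext v
  rw [mem_J]
  exact exists_congr fun k => eq_comm

theorem root_mem_J {i : Fin 8} : root i ∈ J ↔ ∃ k, i = indexJ k := by
  rw [mem_J]
  exact exists_congr fun k => root_injective.eq_iff

theorem indexJ_injective : Function.Injective indexJ := by decide

theorem cartanE7_indexJ (i j : Fin 4) :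
    cartanE7 (indexJ i) (indexJ j) = cartan4A1 i j := by
  rw [cartan4A1, Matrix.diagonal_apply]
  exact (by decide : ∀ i j, entriesE7 (indexJ i) (indexJ j) = if i = j then 2 else 0) i j

theorem isCartan_4A1 : IsCartan cartan4A1 :=
  ⟨fun i => Matrix.diagonal_apply_eq _ i, fun i j h => (Matrix.diagonal_apply_ne _ h).le,
    fun i j h => by
      rw [cartan4A1, Matrix.diagonal_apply] at h ⊢
      rw [eq_comm] at h
      simpa [eq_comm] using h⟩

theorem atMostDouble_4A1 : AtMostDouble cartan4A1 := fun i j h => by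
  simp [cartan4A1, Matrix.diagonal_apply_ne _ h]

theorem coroot_4A1_root (k l : Fin 4) :
    coroot cartan4A1 k (root l) = if l = k then 2 else 0 := by
  rw [coroot_root, cartan4A1, Matrix.diagonal_apply]
  split_ifs <;> simp

theorem coroot_indexJ_root (k l : Fin 4) :
    coroot cartanE7 (indexJ k) (root (indexJ l)) = if l = k then 2 else 0 := by
  rw [coroot_root, cartanE7_indexJ, ← coroot_root, coroot_4A1_root]

theorem s_mul_self (i : Fin 8) : s i * s i = 1 := by
  rw [s, simpleRefl, ← map_mul, simple_mul_self, map_one]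

theorem isLiftable_indexJ :
    (coxeterMatrix cartan4A1).IsLiftable fun k => s (indexJ k) := by
  intro i j
  by_cases h : i = j
  · subst h
    simp [coxeterMatrix, s_mul_self]
  have hm : coxeterMatrix cartan4A1 i j = 2 := by
    simp [coxeterMatrix, h, cartan4A1]
  have hc : s (indexJ i) * s (indexJ j) = s (indexJ j) * s (indexJ i) := by
    rw [s, s, simpleRefl, simpleRefl, ← map_mul, simple_commute, map_mul]
    · exact fun h' => h (indexJ_injective h')
    · rw [cartanE7_indexJ, cartan4A1, Matrix.diagonal_apply_ne _ h, zero_mul]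
  rw [hm, pow_two, mul_assoc, ← mul_assoc (s (indexJ j)), ← hc]
  simp [← mul_assoc, s_mul_self]

/-- The homomorphism `W(4A₁) → W̃(E₇⁽¹⁾)` whose image is `W_J`. -/
noncomputable def homJ : W4A1 →* WE7 :=
  (coxeterMatrix cartan4A1).toCoxeterSystem.lift ⟨_, isLiftable_indexJ⟩

theorem homJ_simple (k : Fin 4) :
    homJ ((coxeterMatrix cartan4A1).simple k) = s (indexJ k) :=
  (coxeterMatrix cartan4A1).toCoxeterSystem.lift_apply_simple isLiftable_indexJ k

theorem range_homJ : homJ.range = WJ := by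
  rw [MonoidHom.range_eq_map,
    ← (coxeterMatrix cartan4A1).toCoxeterSystem.subgroup_closure_range_simple,
    MonoidHom.map_closure, WJ, parabolic, ← Set.range_comp]
  congr 1
  ext g
  simp only [Set.mem_range, Function.comp_apply, toCoxeterSystem_simple, homJ_simple]
  constructor
  · rintro ⟨k, rfl⟩
    exact ⟨_, root_mem_J.2 ⟨k, rfl⟩, rfl⟩
  · rintro ⟨i, hi, rfl⟩
    obtain ⟨k, rfl⟩ := root_mem_J.1 hi
    exact ⟨k, rfl⟩

theorem WJ_eq_closure : WJ = Subgroup.closure {s 0, s 3, s 5, s 7} := by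
  rw [WJ, parabolic]
  congr 1
  ext g
  change (∃ i, root i ∈ J ∧ g = s i) ↔ _
  simp only [root_mem_J, Fin.exists_fin_succ (n := 3), Fin.exists_fin_succ (n := 2),
    Fin.exists_fin_succ (n := 1), Fin.exists_fin_succ (n := 0)]
  simp [indexJ, or_and_right, exists_or]

theorem s_indexJ_mem_WJ (k : Fin 4) : s (indexJ k) ∈ WJ := by
  rw [← range_homJ, ← homJ_simple]
  exact ⟨_, rfl⟩

theorem rep_s_apply (j : Fin 8) (v : Fin 8 → ℝ) :
    rep (s j) v = v - coroot cartanE7 j v • root j :=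
  extRep_simpleRefl_apply _ _ j v

/-- An element of `W(4A₁)` is a product of orthogonal reflections, both in its reflection
representation and in `V`. -/
theorem exists_homJ_formula (x : W4A1) : ∃ d : Fin 4 → ℝ,
    (∀ v, weylRep isCartan_4A1 x v = v - ∑ k, (d k * coroot cartan4A1 k v) • root k) ∧
    ∀ v, rep (homJ x) v = v - ∑ k, (d k * coroot cartanE7 (indexJ k) v) • root (indexJ k) := by
  refine (coxeterMatrix cartan4A1).toCoxeterSystem.simple_induction (p := fun x =>
    ∃ d : Fin 4 → ℝ,
    (∀ v, weylRep isCartan_4A1 x v = v - ∑ k, (d k * coroot cartan4A1 k v) • root k) ∧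
    ∀ v, rep (homJ x) v = v - ∑ k, (d k * coroot cartanE7 (indexJ k) v) • root (indexJ k))
    x (fun i => ?_) ⟨0, fun v => ?_, fun v => ?_⟩ (fun x y => ?_)
  · refine ⟨Pi.single i 1, fun v => ?_, fun v => ?_⟩
    · rw [toCoxeterSystem_simple, weylRep_simple, reflLin_apply]
      simp [Pi.single_apply]
    · rw [toCoxeterSystem_simple, homJ_simple, rep_s_apply]
      simp [Pi.single_apply]
  · simp
  · simp
  · rintro ⟨d, h1, h2⟩ ⟨d', h1', h2'⟩
    -- The factor by which `x` scales the `k`-th root is `1 - 2 * d k`; this is the value of `d` for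
    -- which these factors multiply.
    refine ⟨fun k => d k + d' k - 2 * (d k * d' k), fun v => ?_, fun v => ?_⟩
    · rw [map_mul, LinearEquiv.mul_apply, h1, h1']
      simp only [map_sub, map_sum, map_smul, coroot_4A1_root, smul_eq_mul, mul_ite, mul_zero,
        Finset.sum_ite_eq', Finset.mem_univ, if_true]
      rw [sub_sub, ← Finset.sum_add_distrib]
      congr 1
      refine Finset.sum_congr rfl fun k _ => ?_
      module
    · rw [map_mul, rep_mul, h2, h2']
      simp only [map_sub, map_sum, map_smul, coroot_indexJ_root, smul_eq_mul, mul_ite, mul_zero,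
        Finset.sum_ite_eq', Finset.mem_univ, if_true]
      rw [sub_sub, ← Finset.sum_add_distrib]
      congr 1
      refine Finset.sum_congr rfl fun k _ => ?_
      module

theorem rep_root_of_homJ_formula {g : WE7} {d : Fin 4 → ℝ}
    (h : ∀ v, rep g v = v - ∑ k, (d k * coroot cartanE7 (indexJ k) v) • root (indexJ k))
    (k : Fin 4) : rep g (root (indexJ k)) = (1 - 2 * d k) • root (indexJ k) := by
  rw [h]
  simp only [coroot_indexJ_root, mul_ite, mul_zero, ite_smul, zero_smul, Finset.sum_ite_eq,
    Finset.mem_univ, if_true]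
  module

/-! ### The normaliser of `W_J` -/

theorem mem_NJ {g : WE7} : g ∈ NJ ↔ ∀ k, ∃ l, rep g (root (indexJ k)) = root (indexJ l) := by
  constructor
  · intro h k
    have h' : rep g '' J = J := h
    have : rep g (root (indexJ k)) ∈ J := h' ▸ Set.mem_image_of_mem _ (mem_J.2 ⟨k, rfl⟩)
    exact mem_J.1 this
  · intro h
    change rep g '' J = J
    -- Since `J` is finite and `g` acts injectively, `g J ⊆ J` already gives equality.
    have hfin : J.Finite := by rw [J_eq_range]; exact Set.finite_range _
    refine Set.eq_of_subset_of_ncard_le ?_ ?_ hfin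
    · rintro _ ⟨v, hv, rfl⟩
      obtain ⟨k, rfl⟩ := mem_J.1 hv
      exact mem_J.2 (h k)
    · exact (Set.ncard_image_of_injective J (rep g).injective).ge

/-- An element of `W(4A₁)` whose image stabilises `J` is trivial. -/
theorem eq_one_of_homJ_mem_NJ {x : W4A1} (hx : homJ x ∈ NJ) : x = 1 := by
  obtain ⟨d, h1, h2⟩ := exists_homJ_formula x
  -- The `k`-th root is scaled by `1 - 2 * d k`, and the result is a root of `J`, so the factor is
  -- 1.
  have hd : ∀ k, d k = 0 := by
    intro k
    obtain ⟨l, hl⟩ := mem_NJ.1 hx k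
    rw [rep_root_of_homJ_formula h2] at hl
    have hl' := congrFun hl (indexJ l)
    by_cases hkl : k = l
    · subst hkl
      simp [root] at hl'
      exact hl'
    · have : indexJ l ≠ indexJ k := fun h => hkl (indexJ_injective h).symm
      simp [root, this] at hl'
  -- The same `d` describes `x` in the faithful reflection representation of `W(4A₁)`.
  refine weylRep_injective isCartan_4A1 atMostDouble_4A1 (LinearEquiv.ext fun v => ?_)
  rw [h1]
  simp [hd]

theorem homJ_injective : Function.Injective homJ :=
  (injective_iff_map_eq_one _).2 fun _ hx => eq_one_of_homJ_mem_NJ (hx ▸ one_mem NJ)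

theorem NJ_inf_WJ : NJ ⊓ WJ = ⊥ := by
  rw [eq_bot_iff]
  rintro g ⟨h1, h2⟩
  rw [← range_homJ] at h2
  obtain ⟨x, rfl⟩ := h2
  rw [eq_one_of_homJ_mem_NJ h1, map_one]
  exact one_mem _

theorem conj_mem_WJ {g : WE7} (hg : g ∈ NJ) {x : WE7} (hx : x ∈ WJ) : g * x * g⁻¹ ∈ WJ := by
  suffices WJ ≤ WJ.comap (MulAut.conj g).toMonoidHom from this hx
  conv_lhs => rw [WJ, parabolic]
  rw [Subgroup.closure_le]
  rintro _ ⟨i, hi, rfl⟩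
  obtain ⟨k, rfl⟩ := root_mem_J.1 hi
  obtain ⟨l, hl⟩ := mem_NJ.1 hg k
  have h := mul_simpleRefl_of_extRep_root isCartan_E7 atMostDouble_E7 isSymm_E7 sigmaPermE7 hl
  change g * simpleRefl _ _ _ * g⁻¹ ∈ WJ
  rw [h, mul_inv_cancel_right]
  exact s_indexJ_mem_WJ l

theorem NJ_le_normalizer : NJ ≤ Subgroup.normalizer (WJ : Set WE7) := by
  intro g hg
  rw [Subgroup.mem_normalizer_iff]
  refine fun _ => ⟨conj_mem_WJ hg, fun h => ?_⟩
  have := conj_mem_WJ (inv_mem hg) h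
  simpa [mul_assoc] using this

/-- An element of the normaliser of `W_J` permutes the lines spanned by the roots in `J`. -/
theorem exists_rep_root_of_mem_normalizer {g : WE7} (hg : g ∈ Subgroup.normalizer (WJ : Set WE7))
    (k : Fin 4) : ∃ l, rep g (root (indexJ k)) = root (indexJ l) ∨
      rep g (root (indexJ k)) = -root (indexJ l) := by
  have h := (Subgroup.mem_normalizer_iff.1 hg _).1 (s_indexJ_mem_WJ k)
  rw [← range_homJ] at h
  obtain ⟨x, hx⟩ := h
  obtain ⟨d, -, h2⟩ := exists_homJ_formula x
  rw [hx] at h2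
  -- The displacement of `g u` under `g * s (indexJ k) * g⁻¹`, computed by conjugation on the left
  -- and from membership in `W_J` on the right.
  have key : ∀ u, coroot cartanE7 (indexJ k) u • rep g (root (indexJ k)) =
      ∑ l, (d l * coroot cartanE7 (indexJ l) (rep g u)) • root (indexJ l) := by
    intro u
    have h3 := h2 (rep g u)
    rw [← rep_mul, inv_mul_cancel_right, rep_mul, rep_s_apply, map_sub, map_smul] at h3
    exact sub_right_injective h3
  have hne : rep g (root (indexJ k)) ≠ 0 := by
    rw [Ne, LinearEquiv.map_eq_zero_iff]; exact root_ne_zero _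
  obtain ⟨l, hl⟩ : ∃ l, d l ≠ 0 := by
    by_contra! hd
    have h3 := key (root (indexJ k))
    simp only [hd, zero_mul, zero_smul, Finset.sum_const_zero, coroot_indexJ_root,
      if_true] at h3
    exact hne ((smul_eq_zero.1 h3).resolve_left two_ne_zero)
  -- With `u = g⁻¹ α`, for `α` the `l`-th root of `J`, orthogonality reduces the sum to `2 * d l`
  -- times `α`; this is nonzero, so the image of the `k`-th root is proportional to `α`.
  have h3 := key (rep g⁻¹ (root (indexJ l)))
  rw [← rep_mul, mul_inv_cancel, map_one, LinearEquiv.coe_one, id] at h3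
  simp only [coroot_indexJ_root, mul_ite, mul_zero, ite_smul, zero_smul, Finset.sum_ite_eq,
    Finset.mem_univ, if_true] at h3
  set c := coroot cartanE7 (indexJ k) (rep g⁻¹ (root (indexJ l)))
  have hc : c ≠ 0 := by
    intro hc
    rw [hc, zero_smul, eq_comm, smul_eq_zero] at h3
    exact h3.elim (by simp [hl]) (root_ne_zero _)
  obtain ⟨e, he⟩ : ∃ e : ℝ, rep g (root (indexJ k)) = e • root (indexJ l) :=
    ⟨c⁻¹ * (d l * 2), by rw [mul_smul, ← h3, inv_smul_smul₀ hc]⟩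
  -- Both roots have norm 2 for the invariant form, so the factor `e` satisfies `e ^ 2 = 1`.
  have hform := form_extRep isCartan_E7 isSymm_E7 sigmaPermE7 g (root (indexJ k))
    (root (indexJ k))
  change form _ (rep g _) (rep g _) = _ at hform
  rw [he] at hform
  simp only [map_smul, LinearMap.smul_apply, form_root_right, coroot_indexJ_root, if_true,
    smul_eq_mul] at hform
  have he2 : (e - 1) * (e + 1) = 0 := by linarith
  refine ⟨l, ?_⟩
  rw [he]
  rcases mul_eq_zero.1 he2 with h | h
  · left
    rw [sub_eq_zero.1 h, one_smul]
  · right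
    rw [eq_neg_of_add_eq_zero_left h, neg_one_smul]

open Classical in
/-- The group `W_J` contains all sign changes on `J`. -/
theorem exists_mem_WJ_sign (P : Fin 4 → Prop) : ∃ u ∈ WJ, ∀ k,
    rep u (root (indexJ k)) = if P k then -root (indexJ k) else root (indexJ k) := by
  let f : Fin 4 → WE7 := fun k => if P k then s (indexJ k) else 1
  have hf : ∀ k, f k ∈ WJ := fun k => by
    by_cases h : P k
    · simpa [f, h] using s_indexJ_mem_WJ k
    · simp [f, h, one_mem]
  have hs : ∀ k l, rep (f k) (root (indexJ l)) =
      if k = l ∧ P k then -root (indexJ l) else root (indexJ l) := by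
    intro k l
    by_cases h : P k
    · simp only [f, h, if_true, rep_s_apply, coroot_indexJ_root, and_true]
      by_cases hkl : k = l
      · subst hkl
        simp only [if_true]
        module
      · simp [hkl, Ne.symm hkl]
    · simp [f, h]
  refine ⟨f 0 * f 1 * f 2 * f 3,
    mul_mem (mul_mem (mul_mem (hf 0) (hf 1)) (hf 2)) (hf 3), fun k => ?_⟩
  by_cases hk : P k <;> fin_cases k <;>
  · simp only [Fin.zero_eta, Fin.mk_one, Fin.reduceFinMk] at hk
    simp [-map_mul, rep_mul, hs, hk]

/-- An element of the normaliser permutes `J` up to signs, and right multiplication by a suitable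
sign change from `W_J` removes the signs. -/
theorem NJ_sup_WJ : NJ ⊔ WJ = Subgroup.normalizer (WJ : Set WE7) := by
  refine le_antisymm (sup_le NJ_le_normalizer Subgroup.le_normalizer) fun g hg => ?_
  choose p hp using exists_rep_root_of_mem_normalizer hg
  obtain ⟨u, hu, h⟩ := exists_mem_WJ_sign
    fun k => rep g (root (indexJ k)) = -root (indexJ (p k))
  have hgu : g * u ∈ NJ := mem_NJ.2 fun k => ⟨p k, by
    rw [rep_mul, h]
    split_ifs with hk
    · rw [map_neg, hk, neg_neg]
    · exact (hp k).resolve_right hk⟩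
  have := mul_mem (Subgroup.mem_sup_left hgu : g * u ∈ NJ ⊔ WJ)
    (Subgroup.mem_sup_right (inv_mem hu))
  rwa [mul_inv_cancel_right] at this

theorem normalizer_isInternalSemidirect :
    IsInternalSemidirect (Subgroup.normalizer (WJ : Set WE7)) NJ WJ :=
  ⟨le_rfl, NJ_sup_WJ, NJ_inf_WJ⟩

/-! ### Generation of `N_J` by the `b k` and `σ` -/

/-- The element `s i` of the non-extended Weyl group of type `E₇⁽¹⁾`. -/
abbrev refl (i : Fin 8) : WeylGroup cartanE7 := (coxeterMatrix cartanE7).simple i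

theorem rep_inl (w : WeylGroup cartanE7) :
    rep (SemidirectProduct.inl w) = weylRep isCartan_E7 w :=
  extRep_inl _ _ w

theorem weylRep_mul_refl (w : WeylGroup cartanE7) (i j : Fin 8) :
    weylRep isCartan_E7 (w * refl j) (root i) =
      weylRep isCartan_E7 w (root i) - (entriesE7 i j : ℝ) • weylRep isCartan_E7 w (root j) :=
  weylRep_mul_simple_root _ _ _ _

/-- An element that stabilises `J` and maps a simple root outside `J` to a nonpositive vector
maps it to a vector with a negative coordinate outside `J`. -/
theorem exists_neg_coordinate {w : WeylGroup cartanE7} (hw : SemidirectProduct.inl w ∈ NJ)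
    {i : Fin 8} (hi : root i ∉ J) (hneg : weylRep isCartan_E7 w (root i) ≤ 0) :
    ∃ m, root m ∉ J ∧ weylRep isCartan_E7 w (root i) m < 0 := by
  -- Otherwise `w α_i` lies in the span of `J`; since `w⁻¹` preserves `J`, so would `α_i`.
  by_contra! hm
  have h0 : ∀ m, root m ∉ J → weylRep isCartan_E7 w (root i) m = 0 :=
    fun m h => le_antisymm (hneg m) (hm m h)
  set v := weylRep isCartan_E7 w (root i) with hv
  have hsum : v = ∑ k, v (indexJ k) • root (indexJ k) := by
    ext m
    by_cases h : root m ∈ J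
    · obtain ⟨k, rfl⟩ := root_mem_J.1 h
      simp [root, Pi.single_apply, indexJ_injective.eq_iff]
    · rw [h0 m h]
      have : ∀ k, m ≠ indexJ k := fun k hk => h (root_mem_J.2 ⟨k, hk⟩)
      simp [root, this]
  have hback : root i = ∑ k, v (indexJ k) • rep (SemidirectProduct.inl w)⁻¹ (root (indexJ k)) := by
    rw [← map_inv, rep_inl]
    simp_rw [← map_smul]
    rw [← map_sum, ← hsum, hv, ← LinearEquiv.mul_apply, ← map_mul, inv_mul_cancel, map_one]
    rfl
  have hz : ∀ k, rep (SemidirectProduct.inl w)⁻¹ (root (indexJ k)) i = 0 := by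
    intro k
    obtain ⟨l, hl⟩ := mem_NJ.1 (inv_mem hw) k
    have : i ≠ indexJ l := fun h => hi (root_mem_J.2 ⟨l, h⟩)
    rw [hl]
    simp [root, this]
  have h1 := congrFun hback i
  simp only [Finset.sum_apply, Pi.smul_apply, hz, smul_zero, Finset.sum_const_zero] at h1
  simp [root] at h1

/-- Right multiplication by `s i * s p * s q * s i`, where `i` is joined to the disconnected
nodes `p` and `q` of `J`, decreases the length of an element that stabilises `J` and has `i` as a
right descent. -/
theorem len_mul_lt {w : WeylGroup cartanE7} (hw : SemidirectProduct.inl w ∈ NJ)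
    {i : Fin 8} (k l : Fin 4) (hi : root i ∉ J)
    (hd : len cartanE7 (w * refl i) < len cartanE7 w)
    (hk : entriesE7 (indexJ k) i = -1) (hl : entriesE7 (indexJ l) i = -1)
    (hkl : entriesE7 (indexJ l) (indexJ k) = 0) :
    len cartanE7 (w * refl i * refl (indexJ k) * refl (indexJ l) * refl i) < len cartanE7 w := by
  obtain ⟨m, hm, hneg⟩ := exists_neg_coordinate hw hi
    (weylRep_root_nonpos isCartan_E7 atMostDouble_E7 w i hd)
  have hJ : ∀ k, weylRep isCartan_E7 w (root (indexJ k)) m = 0 := by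
    intro k
    obtain ⟨l, hl⟩ := mem_NJ.1 hw k
    have : m ≠ indexJ l := fun h => hm (root_mem_J.2 ⟨l, h⟩)
    rw [← rep_inl, hl]
    simp [root, this]
  -- Each of the two middle letters is a descent: the relevant root is sent to `w α_i` plus the
  -- image of a root of `J`, whose coordinate at `m` vanishes.
  have h1 := len_mul_simple_lt isCartan_E7 atMostDouble_E7 (w * refl i) (indexJ k) m (by
    rw [weylRep_mul_refl, hk]
    simpa [hJ] using hneg)
  have h2 := len_mul_simple_lt isCartan_E7 atMostDouble_E7 (w * refl i * refl (indexJ k))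
    (indexJ l) m (by
      rw [weylRep_mul_refl, weylRep_mul_refl, hl, hkl]
      simpa [hJ] using hneg)
  -- The first three letters each lower the length by one and the last raises it by at most one.
  have h3 := len_mul_simple cartanE7 (w * refl i * refl (indexJ k) * refl (indexJ l)) i
  simp only [refl] at *
  omega

theorem b_mem_NJ (k : Fin 4) : b k ∈ NJ := by
  refine mem_NJ.2 fun l => ?_
  fin_cases k
  · exact ⟨![1, 0, 2, 3] l, by fin_cases l <;> simp [indexJ, rep_b0]⟩
  · exact ⟨![0, 1, 3, 2] l, by fin_cases l <;> simp [indexJ, rep_b1]⟩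
  · exact ⟨![0, 2, 1, 3] l, by fin_cases l <;> simp [indexJ, rep_b2]⟩
  · exact ⟨l, by fin_cases l <;> simp [indexJ, rep_b3]⟩

theorem σ_mem_NJ : σ ∈ NJ := by
  refine mem_NJ.2 fun l => ⟨![3, 2, 1, 0] l, ?_⟩
  rw [rep_σ]
  exact congrArg root ((by decide : ∀ l, permE7 (indexJ l) = indexJ (![3, 2, 1, 0] l)) l)

/-- The subgroup generated by the elements `b i`. -/
noncomputable def subgroupB : Subgroup WE7 := Subgroup.closure {b 1, b 2, b 3, b 0}

theorem b_mem_subgroupB (k : Fin 4) : b k ∈ subgroupB := by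
  refine Subgroup.subset_closure ?_
  fin_cases k <;> simp

theorem subgroupB_le {H : Subgroup WE7} (h : ∀ k, b k ∈ H) : subgroupB ≤ H := by
  rw [subgroupB, Subgroup.closure_le]
  rintro _ (rfl | rfl | rfl | rfl) <;> exact h _

theorem subgroupB_le_NJ : subgroupB ≤ NJ := subgroupB_le b_mem_NJ

/-- Every simple root outside `J` that is mapped to a nonpositive vector by an element
stabilising `J` yields a generator `b k` shortening that element. -/
theorem exists_b_len_lt {w : WeylGroup cartanE7} (hw : SemidirectProduct.inl w ∈ NJ)
    (h1 : w ≠ 1) : ∃ (k : Fin 4) (u : WeylGroup cartanE7),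
      SemidirectProduct.inl u = b k ∧ len cartanE7 (w * u) < len cartanE7 w := by
  obtain ⟨i, hi⟩ := exists_descent cartanE7 h1
  -- A descent is never in `J`, because `w` sends roots of `J` to simple roots.
  have hJ : root i ∉ J := by
    intro h
    obtain ⟨k, rfl⟩ := root_mem_J.1 h
    obtain ⟨l, hl⟩ := mem_NJ.1 hw k
    have hneg := weylRep_root_nonpos isCartan_E7 atMostDouble_E7 w _ hi
    rw [← rep_inl, hl] at hneg
    exact root_ne_zero _ (le_antisymm hneg (root_nonneg _))
  have hne : ∀ k, i ≠ indexJ k := fun k h => hJ (root_mem_J.2 ⟨k, h⟩)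
  have hcases : i = 1 ∨ i = 6 ∨ i = 4 ∨ i = 2 := by
    revert hne
    clear hi hJ
    revert i
    decide
  rcases hcases with rfl | rfl | rfl | rfl
  · refine ⟨0, refl 1 * refl 3 * refl 0 * refl 1, rfl, ?_⟩
    simp only [← mul_assoc]
    exact len_mul_lt hw 1 0 hJ hi (by decide) (by decide) (by decide)
  · refine ⟨1, refl 6 * refl 5 * refl 7 * refl 6, rfl, ?_⟩
    simp only [← mul_assoc]
    exact len_mul_lt hw 2 3 hJ hi (by decide) (by decide) (by decide)
  · refine ⟨2, refl 4 * refl 5 * refl 3 * refl 4, rfl, ?_⟩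
    simp only [← mul_assoc]
    exact len_mul_lt hw 2 1 hJ hi (by decide) (by decide) (by decide)
  · exact ⟨3, refl 2, rfl, hi⟩

theorem inl_mem_subgroupB {w : WeylGroup cartanE7} (hw : SemidirectProduct.inl w ∈ NJ) :
    SemidirectProduct.inl w ∈ subgroupB := by
  induction hn : len cartanE7 w using Nat.strong_induction_on generalizing w with
  | _ n ih =>
  subst hn
  by_cases h1 : w = 1
  · rw [h1, map_one]; exact one_mem _
  obtain ⟨k, u, hu, hlt⟩ := exists_b_len_lt hw h1
  have h := ih _ hlt (w := w * u) (by rw [map_mul, hu]; exact mul_mem hw (b_mem_NJ k)) rfl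
  rw [map_mul, hu] at h
  simpa using mul_mem h (inv_mem (b_mem_subgroupB k))

theorem range_inr : (SemidirectProduct.inr : Subgroup.zpowers sigmaPermE7 →* WE7).range =
    Subgroup.zpowers σ := by
  refine le_antisymm ?_ ?_
  · rintro _ ⟨⟨_, n, rfl⟩, rfl⟩
    refine ⟨n, ?_⟩
    change σ ^ n = _
    rw [σ, diagGen, ← map_zpow]
    rfl
  · rw [Subgroup.zpowers_le]
    exact ⟨_, rfl⟩

/-- As `σ` stabilises `J`, the Weyl group component of an element of `N_J` also does, and
`inl_mem_subgroupB` applies to it. -/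
theorem zpowers_sup_subgroupB : Subgroup.zpowers σ ⊔ subgroupB = NJ := by
  have hσ : Subgroup.zpowers σ ≤ NJ := Subgroup.zpowers_le.2 σ_mem_NJ
  refine le_antisymm (sup_le hσ subgroupB_le_NJ) fun g hg => ?_
  obtain ⟨w, t⟩ := g
  have ht : SemidirectProduct.inr t ∈ Subgroup.zpowers σ := range_inr ▸ ⟨t, rfl⟩
  rw [SemidirectProduct.mk_eq_inl_mul_inr] at hg ⊢
  have hw := mul_mem hg (inv_mem (hσ ht))
  rw [mul_inv_cancel_right] at hw
  exact mul_mem (Subgroup.mem_sup_right (inl_mem_subgroupB hw)) (Subgroup.mem_sup_left ht)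

theorem zpowers_inf_subgroupB : Subgroup.zpowers σ ⊓ subgroupB = ⊥ := by
  rw [eq_bot_iff]
  rintro g ⟨h1, h2⟩
  -- The `b k` lie in the non-extended Weyl group, the kernel of the projection to the diagram
  -- automorphisms.
  have hker : subgroupB ≤ (SemidirectProduct.rightHom :
      WE7 →* Subgroup.zpowers sigmaPermE7).ker := subgroupB_le fun k => by
    fin_cases k <;> simp [b, s, simpleRefl, MonoidHom.mem_ker]
  rw [← range_inr] at h1
  obtain ⟨t, rfl⟩ := h1
  have ht := hker h2
  rw [MonoidHom.mem_ker, SemidirectProduct.rightHom_inr] at ht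
  rw [ht, map_one]
  exact one_mem _

theorem σ_inv : σ⁻¹ = σ := inv_eq_of_mul_eq_one_left σ_mul_self

theorem σ_conj_mem {g : WE7} (hg : g ∈ subgroupB) : σ * g * σ⁻¹ ∈ subgroupB := by
  suffices subgroupB ≤ subgroupB.comap (MulAut.conj σ).toMonoidHom from this hg
  refine subgroupB_le fun k => ?_
  change σ * b k * σ⁻¹ ∈ subgroupB
  rw [σ_mul_b, mul_inv_cancel_right]
  exact b_mem_subgroupB _

theorem σ_mem_normalizer : σ ∈ Subgroup.normalizer (subgroupB : Set WE7) := by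
  refine Subgroup.mem_normalizer_iff.2 fun g => ⟨σ_conj_mem, fun h => ?_⟩
  have := σ_conj_mem h
  rw [σ_inv] at this
  simpa [mul_assoc, σ_mul_self, ← mul_assoc σ σ] using this

theorem NJ_isInternalSemidirect :
    IsInternalSemidirect NJ (Subgroup.zpowers σ) (Subgroup.closure {b 1, b 2, b 3, b 0}) :=
  ⟨zpowers_sup_subgroupB.ge.trans
      (sup_le (Subgroup.zpowers_le.2 σ_mem_normalizer) Subgroup.le_normalizer),
    zpowers_sup_subgroupB, zpowers_inf_subgroupB⟩

/-! ### The isomorphism of `N_J` with the extended group of type `B₃⁽¹⁾` -/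

theorem isCartan_B3 : IsCartan cartanB3 :=
  ⟨(by decide : ∀ i : Fin 4, entriesB3 i i = 2),
    (by decide : ∀ i j : Fin 4, i ≠ j → entriesB3 i j ≤ 0),
    (by decide : ∀ i j : Fin 4, entriesB3 i j = 0 → entriesB3 j i = 0)⟩

theorem atMostDouble_B3 : AtMostDouble cartanB3 :=
  (by decide : ∀ i j : Fin 4, i ≠ j → entriesB3 i j * entriesB3 j i ≤ 2)

theorem mul_pow_comm {G : Type} [Group G] {x y : G} {n : ℕ} (hx : x * x = 1) (hy : y * y = 1)
    (h : (x * y) ^ n = 1) : (y * x) ^ n = 1 := by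
  have : y * x = (x * y)⁻¹ := by
    rw [mul_inv_rev, inv_eq_of_mul_eq_one_left hx, inv_eq_of_mul_eq_one_left hy]
  rw [this, inv_pow, h, inv_one]

theorem isLiftable_b : (coxeterMatrix cartanB3).IsLiftable b := by
  have hM : ∀ {i j n}, coxeterMatrix cartanB3 i j = n → (b i * b j) ^ n = 1 →
      (b i * b j) ^ coxeterMatrix cartanB3 i j = 1 := fun h h' => h ▸ h'
  have hsymm : ∀ {i j n}, coxeterMatrix cartanB3 j i = n → (b i * b j) ^ n = 1 →
      (b j * b i) ^ coxeterMatrix cartanB3 j i = 1 :=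
    fun h h' => hM h (mul_pow_comm (b_mul_self _) (b_mul_self _) h')
  have hdiag : ∀ i, (b i * b i) ^ coxeterMatrix cartanB3 i i = 1 :=
    fun i => by rw [b_mul_self, one_pow]
  obtain ⟨h01, h03, h13⟩ := b_pow_two
  obtain ⟨h02, h12⟩ := b_pow_three
  have h23 := b_pow_four
  intro i j
  match i, j with
  | 0, 0 => exact hdiag 0
  | 0, 1 => exact hM rfl h01
  | 0, 2 => exact hM rfl h02
  | 0, 3 => exact hM rfl h03
  | 1, 0 => exact hsymm rfl h01
  | 1, 1 => exact hdiag 1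
  | 1, 2 => exact hM rfl h12
  | 1, 3 => exact hM rfl h13
  | 2, 0 => exact hsymm rfl h02
  | 2, 1 => exact hsymm rfl h12
  | 2, 2 => exact hdiag 2
  | 2, 3 => exact hM rfl h23
  | 3, 0 => exact hsymm rfl h03
  | 3, 1 => exact hsymm rfl h13
  | 3, 2 => exact hsymm rfl h23
  | 3, 3 => exact hdiag 3

/-- The homomorphism `W(B₃⁽¹⁾) → W̃(E₇⁽¹⁾)` with `s i ↦ b i`. -/
noncomputable def homWeylB : WeylGroup cartanB3 →* WE7 :=
  (coxeterMatrix cartanB3).toCoxeterSystem.lift ⟨b, isLiftable_b⟩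

theorem homWeylB_simple (k : Fin 4) : homWeylB ((coxeterMatrix cartanB3).simple k) = b k :=
  (coxeterMatrix cartanB3).toCoxeterSystem.lift_apply_simple isLiftable_b k

/-- The generator of the cyclic group `⟨σ'⟩`. -/
def genB3 : Subgroup.zpowers sigmaPermB3 := ⟨sigmaPermB3, Subgroup.mem_zpowers _⟩

theorem mem_zpowers_genB3 (x : Subgroup.zpowers sigmaPermB3) : x ∈ Subgroup.zpowers genB3 := by
  obtain ⟨_, n, rfl⟩ := x
  exact ⟨n, Subtype.ext rfl⟩

theorem orderOf_genB3 : orderOf genB3 = 2 := by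
  refine orderOf_eq_prime ?_ fun h => ?_
  · refine Subtype.ext (Subtype.ext ?_)
    change Equiv.swap (0 : Fin 4) 1 ^ 2 = 1
    decide
  · have h' : Equiv.swap (0 : Fin 4) 1 = 1 := congrArg (fun x => x.1.1) h
    exact absurd h' (by decide)

/-- The homomorphism `⟨σ'⟩ → W̃(E₇⁽¹⁾)` with `σ' ↦ σ`. -/
noncomputable def homDiagB : Subgroup.zpowers sigmaPermB3 →* WE7 :=
  monoidHomOfForallMemZpowers (g := genB3) (g' := σ) mem_zpowers_genB3 (by
    rw [orderOf_genB3]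
    exact orderOf_dvd_of_pow_eq_one (by rw [pow_two, σ_mul_self]))

theorem homDiagB_gen : homDiagB genB3 = σ := monoidHomOfForallMemZpowers_apply_gen _ _

theorem homWeylB_autAction (t : Subgroup.zpowers sigmaPermB3) (w : WeylGroup cartanB3) :
    homWeylB (autAction cartanB3 t.1 w) = homDiagB t * homWeylB w * (homDiagB t)⁻¹ := by
  have hgen : ∀ w, homWeylB (autAction cartanB3 sigmaPermB3 w) =
      σ * homWeylB w * σ⁻¹ := by
    have : homWeylB.comp (autAction cartanB3 sigmaPermB3).toMonoidHom =
        (MulAut.conj σ).toMonoidHom.comp homWeylB := by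
      refine weylGroup_hom_ext _ fun k => ?_
      change homWeylB (autHom _ _ _) = σ * homWeylB _ * σ⁻¹
      rw [autHom_simple, homWeylB_simple, homWeylB_simple, σ_mul_b, mul_inv_cancel_right]
      rfl
    exact fun w => DFunLike.congr_fun this w
  obtain ⟨n, rfl⟩ := Subgroup.mem_zpowers_iff.1 (mem_zpowers_genB3 t)
  have h2 : genB3 ^ (2 : ℤ) = 1 := by
    have := pow_orderOf_eq_one genB3
    rw [orderOf_genB3] at this
    exact_mod_cast this
  obtain ⟨m, rfl | rfl⟩ := Int.even_or_odd' n
  · rw [zpow_mul, h2, one_zpow]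
    simp
  · rw [zpow_add, zpow_mul, h2, one_zpow, one_mul, zpow_one, homDiagB_gen]
    exact hgen w

/-- The homomorphism `W̃(B₃⁽¹⁾) → W̃(E₇⁽¹⁾)` with `s i ↦ b i` and `σ' ↦ σ`. -/
noncomputable def homB : WB3 →* WE7 :=
  SemidirectProduct.lift homWeylB homDiagB fun t =>
    MonoidHom.ext fun w => homWeylB_autAction t w

theorem homB_simpleRefl (k : Fin 4) : homB (simpleRefl cartanB3 sigmaPermB3 k) = b k := by
  rw [homB, simpleRefl, SemidirectProduct.lift_inl, homWeylB_simple]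

theorem homB_diagGen : homB (diagGen cartanB3 sigmaPermB3) = σ := by
  rw [homB, diagGen, SemidirectProduct.lift_inr]
  exact homDiagB_gen

theorem homWeylB_mem (w : WeylGroup cartanB3) : homWeylB w ∈ subgroupB := by
  refine (coxeterMatrix cartanB3).toCoxeterSystem.simple_induction
    (p := fun w => homWeylB w ∈ subgroupB) w (fun k => ?_) ?_ (fun x y hx hy => ?_)
  · rw [toCoxeterSystem_simple, homWeylB_simple]
    exact b_mem_subgroupB k
  · rw [map_one]
    exact one_mem _
  · rw [map_mul]
    exact mul_mem hx hy

theorem homDiagB_mem (t : Subgroup.zpowers sigmaPermB3) : homDiagB t ∈ Subgroup.zpowers σ := by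
  obtain ⟨n, rfl⟩ := Subgroup.mem_zpowers_iff.1 (mem_zpowers_genB3 t)
  rw [map_zpow, homDiagB_gen]
  exact ⟨n, rfl⟩

theorem range_homB : homB.range = NJ := by
  refine le_antisymm ?_ ?_
  · rintro _ ⟨⟨w, t⟩, rfl⟩
    rw [SemidirectProduct.mk_eq_inl_mul_inr, map_mul, homB, SemidirectProduct.lift_inl,
      SemidirectProduct.lift_inr]
    exact mul_mem (subgroupB_le_NJ (homWeylB_mem w))
      (Subgroup.zpowers_le.2 σ_mem_NJ (homDiagB_mem t))
  · rw [← zpowers_sup_subgroupB]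
    exact sup_le (Subgroup.zpowers_le.2 ⟨_, homB_diagGen⟩)
      (subgroupB_le fun k => ⟨_, homB_simpleRefl k⟩)

/-- The action of the extended group of type `B₃⁽¹⁾` on its root space. -/
noncomputable abbrev repB : WB3 →* ((Fin 4 → ℝ) ≃ₗ[ℝ] (Fin 4 → ℝ)) :=
  extRep isCartan_B3 sigmaPermB3

/-- The images of the simple roots of `E₇⁽¹⁾` in the root space of `B₃⁽¹⁾`. -/
def projRoot : Fin 8 → Fin 4 → ℝ :=
  -- The factor 2 reconciles the simple bond between 2 and 4 with the double bond of `B₃⁽¹⁾`: `b 3`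
  -- sends `α₄` to `α₄ + α₂`, whereas the reflection in the short root `β₃` sends `β₂` to `β₂ + 2
  -- β₃`.
  ![0, root 0, (2 : ℝ) • root 3, 0, root 2, 0, root 1, 0]

/-- The projection, with kernel spanned by `J`, of the root space of `E₇⁽¹⁾` onto the root space
of `B₃⁽¹⁾`. -/
noncomputable def proj : (Fin 8 → ℝ) →ₗ[ℝ] (Fin 4 → ℝ) :=
  ∑ i, (LinearMap.proj i : (Fin 8 → ℝ) →ₗ[ℝ] ℝ).smulRight (projRoot i)

theorem proj_root (i : Fin 8) : proj (root i) = projRoot i := by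
  simp [proj, root, Pi.single_apply]

theorem repB_simpleRefl (i j : Fin 4) : repB (simpleRefl cartanB3 sigmaPermB3 j) (root i) =
    root i - (entriesB3 i j : ℝ) • root j :=
  extRep_refl _ _ i j

theorem repB_diagGen (i : Fin 4) : repB (diagGen cartanB3 sigmaPermB3) (root i) =
    root ((![1, 0, 2, 3] : Fin 4 → Fin 4) i) :=
  (extRep_diag _ _ i).trans (congrArg root
    ((by decide : ∀ i, (Equiv.swap 0 1 : Equiv.Perm (Fin 4)) i =
      (![1, 0, 2, 3] : Fin 4 → Fin 4) i) i))

theorem linearMap_ext_root {n : ℕ} {V : Type} [AddCommGroup V] [Module ℝ V]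
    {f g : (Fin n → ℝ) →ₗ[ℝ] V} (h : ∀ i, f (root i) = g (root i)) : f = g := by
  refine LinearMap.pi_ext' fun i => ?_
  ext1
  exact h i

theorem proj_rep_b (k : Fin 4) (v : Fin 8 → ℝ) :
    proj (rep (b k) v) = repB (simpleRefl cartanB3 sigmaPermB3 k) (proj v) := by
  have : proj.comp (rep (b k)).toLinearMap =
      (repB (simpleRefl cartanB3 sigmaPermB3 k)).toLinearMap.comp proj := by
    refine linearMap_ext_root fun i => ?_
    simp only [LinearMap.comp_apply, LinearEquiv.coe_coe, proj_root]
    fin_cases k <;> fin_cases i <;>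
    · simp [rep_b0, rep_b1, rep_b2, rep_b3, proj_root, projRoot, repB_simpleRefl, entriesB3]
      try module
  exact LinearMap.congr_fun this v

theorem proj_rep_σ (v : Fin 8 → ℝ) :
    proj (rep σ v) = repB (diagGen cartanB3 sigmaPermB3) (proj v) := by
  have : proj.comp (rep σ).toLinearMap =
      (repB (diagGen cartanB3 sigmaPermB3)).toLinearMap.comp proj := by
    refine linearMap_ext_root fun i => ?_
    simp only [LinearMap.comp_apply, LinearEquiv.coe_coe, proj_root, rep_σ, permE7_table]
    fin_cases i <;> simp [projRoot, repB_diagGen]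
  exact LinearMap.congr_fun this v

theorem proj_rep_homB (x : WB3) (v : Fin 8 → ℝ) : proj (rep (homB x) v) = repB x (proj v) := by
  obtain ⟨w, t⟩ := x
  rw [SemidirectProduct.mk_eq_inl_mul_inr]
  have hmul : ∀ x y : WB3, (∀ v, proj (rep (homB x) v) = repB x (proj v)) →
      (∀ v, proj (rep (homB y) v) = repB y (proj v)) →
      ∀ v, proj (rep (homB (x * y)) v) = repB (x * y) (proj v) := by
    intro x y hx hy v
    rw [map_mul, rep_mul, hx, hy]
    exact (extRep_mul_apply _ _ x y _).symm
  refine hmul _ _ ?_ ?_ v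
  · refine (coxeterMatrix cartanB3).toCoxeterSystem.simple_induction
      (p := fun w => ∀ v, proj (rep (homB (SemidirectProduct.inl w)) v) =
        repB (SemidirectProduct.inl w) (proj v)) w (fun k v => ?_) (fun v => ?_)
      (fun x y hx hy => ?_)
    · have h := homB_simpleRefl k
      rw [simpleRefl] at h
      rw [toCoxeterSystem_simple, h, proj_rep_b, simpleRefl]
    · simp
    · rw [map_mul]
      exact hmul _ _ hx hy
  · have hσ : ∀ v, proj (rep (homB (SemidirectProduct.inr genB3)) v) =
        repB (SemidirectProduct.inr genB3) (proj v) := fun v => by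
      have h := proj_rep_σ v
      rwa [← homB_diagGen] at h
    -- Finite order makes the exponent a natural number, so the induction needs no case for
    -- inverses.
    obtain ⟨n, rfl⟩ := (IsOfFinOrder.mem_powers_iff_mem_zpowers
      (orderOf_pos_iff.1 (by rw [orderOf_genB3]; norm_num))).2 (mem_zpowers_genB3 t)
    change ∀ v, proj (rep (homB (SemidirectProduct.inr (genB3 ^ n))) v) =
      repB (SemidirectProduct.inr (genB3 ^ n)) (proj v)
    induction n with
    | zero => intro v; simp
    | succ n ih =>
      rw [pow_succ, map_mul]
      exact hmul _ _ ih hσ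

theorem exists_proj_eq_root (k : Fin 4) : ∃ v, proj v = root k := by
  fin_cases k
  · exact ⟨root 1, proj_root 1⟩
  · exact ⟨root 6, proj_root 6⟩
  · exact ⟨root 4, proj_root 4⟩
  · exact ⟨(1 / 2 : ℝ) • root 2, by rw [map_smul, proj_root]; simp [projRoot]⟩

/-- If `homB x = 1`, the intertwining property of `proj` makes `x` act trivially on its image, which
contains every simple root of `B₃⁽¹⁾`. -/
theorem homB_injective : Function.Injective homB := by
  refine (injective_iff_map_eq_one _).2 fun x hx => ?_
  refine ext_of_root isCartan_B3 atMostDouble_B3 sigmaPermB3 fun k => ?_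
  obtain ⟨v, hv⟩ := exists_proj_eq_root k
  have h := proj_rep_homB x v
  rw [hx, map_one, hv] at h
  rw [map_one]
  exact h.symm.trans hv

/-! ### From internal to external semidirect products -/

/-- Two embedded subgroups, one of them normalising the other, that form an internal semidirect
product give an isomorphism with an external semidirect product. -/
theorem exists_semidirectProduct_mulEquiv {K N H : Type} [Group K] [Group N] [Group H]
    {G : Subgroup K} (f : N →* K) (g : H →* K) (hf : Function.Injective f)
    (hg : Function.Injective g) (h : IsInternalSemidirect G g.range f.range) :
    ∃ (φ : H →* MulAut N) (e : N ⋊[φ] H ≃* G),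
      (∀ n, (e (SemidirectProduct.inl n) : K) = f n) ∧
      ∀ x, (e (SemidirectProduct.inr x) : K) = g x := by
  have hgG : ∀ x, g x ∈ G := fun x => h.sup_eq ▸ Subgroup.mem_sup_left ⟨x, rfl⟩
  have hfG : ∀ n, f n ∈ G := fun n => h.sup_eq ▸ Subgroup.mem_sup_right ⟨n, rfl⟩
  let fe : N ≃* f.range := MonoidHom.ofInjective hf
  -- The action `φ` is conjugation by `g x` on the image of `f`, transported back along `f`.
  let ν : H →* MulAut f.range := f.range.normalizerMonoidHom.comp
    (g.codRestrict (Subgroup.normalizer (f.range : Set K)) fun x => h.normal (hgG x))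
  let φ : H →* MulAut N := (MulAut.congr fe.symm).toMonoidHom.comp ν
  have hφ : ∀ x n, f (φ x n) = g x * f n * (g x)⁻¹ := by
    intro x n
    have h1 : f (φ x n) = fe (φ x n) := rfl
    have h2 : fe (φ x n) = ν x (fe n) := fe.apply_symm_apply _
    rw [h1, h2]
    rfl
  let e' : N ⋊[φ] H →* G := SemidirectProduct.lift (f.codRestrict G hfG) (g.codRestrict G hgG)
    fun x => by
      ext n
      exact hφ x n
  have he : ∀ n x, (e' ⟨n, x⟩ : K) = f n * g x := fun n x => rfl
  refine ⟨φ, MulEquiv.ofBijective e' ⟨?_, ?_⟩, fun n => ?_, fun x => ?_⟩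
  · refine (injective_iff_map_eq_one _).2 ?_
    rintro ⟨n, x⟩ hnx
    have h1 : f n * g x = 1 := by rw [← he, hnx]; rfl
    have h2 : g x ∈ g.range ⊓ f.range :=
      ⟨⟨x, rfl⟩, ⟨n⁻¹, by rw [map_inv]; exact inv_eq_of_mul_eq_one_right h1⟩⟩
    rw [h.inf_eq, Subgroup.mem_bot] at h2
    rw [h2, mul_one] at h1
    rw [(injective_iff_map_eq_one _).1 hf n h1, (injective_iff_map_eq_one _).1 hg x h2]
    rfl
  · have hrange : G ≤ e'.range.map G.subtype := by
      conv_lhs => rw [← h.sup_eq]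
      refine sup_le ?_ ?_
      · rintro _ ⟨x, rfl⟩
        exact ⟨_, ⟨SemidirectProduct.inr x, rfl⟩, (he 1 x).trans (by simp)⟩
      · rintro _ ⟨n, rfl⟩
        exact ⟨_, ⟨SemidirectProduct.inl n, rfl⟩, (he n 1).trans (by simp)⟩
    rintro ⟨y, hy⟩
    obtain ⟨_, ⟨z, rfl⟩, hz⟩ := hrange hy
    exact ⟨z, Subtype.ext hz⟩
  · exact (he n 1).trans (by simp)
  · exact (he 1 x).trans (by simp)

end AffineWeyl

theorem mainTheorem5 :
    -- `J` is of type `4A₁`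
    (∀ i j, AffineWeyl.cartanE7 (AffineWeyl.indexJ i) (AffineWeyl.indexJ j)
      = AffineWeyl.cartan4A1 i j) ∧
    -- `W_J = ⟨s₀, s₃, s₅, s₇⟩`
    AffineWeyl.WJ = Subgroup.closure
      {AffineWeyl.s 0, AffineWeyl.s 3, AffineWeyl.s 5, AffineWeyl.s 7} ∧
    -- `N(W_J) = N_J ⋉ W_J`
    AffineWeyl.IsInternalSemidirect
      (Subgroup.normalizer (AffineWeyl.WJ : Set AffineWeyl.WE7)) AffineWeyl.NJ AffineWeyl.WJ ∧
    -- `N_J = ⟨b₁, b₂, b₃, b₀⟩ ⋊ ⟨σ⟩`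
    AffineWeyl.IsInternalSemidirect AffineWeyl.NJ (Subgroup.zpowers AffineWeyl.σ)
      (Subgroup.closure
        {AffineWeyl.b 1, AffineWeyl.b 2, AffineWeyl.b 3, AffineWeyl.b 0}) ∧
    -- `N(W_J)` is isomorphic to the semidirect product of the extended affine Weyl group of type
    -- `B₃⁽¹⁾` and `W(4A₁)`, the generators corresponding to each other
    ∃ (φ : AffineWeyl.WB3 →* MulAut AffineWeyl.W4A1)
      (e : AffineWeyl.W4A1 ⋊[φ] AffineWeyl.WB3 ≃*
        Subgroup.normalizer (AffineWeyl.WJ : Set AffineWeyl.WE7)),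
      (∀ k : Fin 4,
        (e (SemidirectProduct.inl
            ((AffineWeyl.coxeterMatrix AffineWeyl.cartan4A1).simple k)) : AffineWeyl.WE7)
          = AffineWeyl.s (AffineWeyl.indexJ k)) ∧
      (∀ i : Fin 4,
        (e (SemidirectProduct.inr
            (AffineWeyl.simpleRefl AffineWeyl.cartanB3 AffineWeyl.sigmaPermB3 i)) : AffineWeyl.WE7)
          = AffineWeyl.b i) ∧
      (e (SemidirectProduct.inr
          (AffineWeyl.diagGen AffineWeyl.cartanB3 AffineWeyl.sigmaPermB3)) : AffineWeyl.WE7)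
        = AffineWeyl.σ := by
  refine ⟨AffineWeyl.cartanE7_indexJ, AffineWeyl.WJ_eq_closure,
    AffineWeyl.normalizer_isInternalSemidirect, AffineWeyl.NJ_isInternalSemidirect, ?_⟩
  obtain ⟨φ, e, h1, h2⟩ := AffineWeyl.exists_semidirectProduct_mulEquiv AffineWeyl.homJ
    AffineWeyl.homB AffineWeyl.homJ_injective AffineWeyl.homB_injective
    (G := Subgroup.normalizer (AffineWeyl.WJ : Set AffineWeyl.WE7)) (by
      rw [AffineWeyl.range_homB, AffineWeyl.range_homJ]
      exact AffineWeyl.normalizer_isInternalSemidirect)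
  exact ⟨φ, e, fun k => (h1 _).trans (AffineWeyl.homJ_simple k),
    fun i => (h2 _).trans (AffineWeyl.homB_simpleRefl i), (h2 _).trans AffineWeyl.homB_diagGen⟩
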